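/- Let $n$ (and $m$) be positive integers and $a,b,c\in\mathbb C$. Write $${}_3F_2(a_1,a_2,a_3;b_1,b_2|1)=\sum_{k\ge0}\frac{(a_1)_k(a_2)_k(a_3)_k}{(b_1)_k(b_2)_k\,k!},$$ with excess $s=b_1+b_2-a_1-a_2-a_3$. In (B.2), (B.3), (B.6), (B.7), (B.62) this is the sum of the (terminating or convergent) series. In (B.1), (B.4), (B.5), (B.63), (B.64) it is the sum of the series when $\operatorname{Re}s>0$, and in general its analytic continuation in the parameters to the set where none of $b_1,b_2,s$ lies in $\{0,-1,-2,\dots\}$. Assume in each formula that no lower parameter is in $\{0,-1,-2,\dots\}$, that no gamma function in a numerator on the right-hand side is at a pole, and in (B.1), (B.4), (B.5), (B.63), (B.64) that $s\notin\{0,-1,-2,\dots\}$; $1/\Gamma$ is $0$ at the poles of $\Gamma$. Then: (B.1) If $n<m$, then $${}_3F_2(a,m,b;c,m-n|1)=\frac{(-1)^n\Gamma(a+n-m+1)\Gamma(c)\Gamma(m-n)}{\Gamma(c-a)\Gamma(a)}\sum_{L=0}^{m-1}\frac{(-1)^L\,\Gamma(c-a-b-n+L)\Gamma(1-b+L)}{\Gamma(m-L)\Gamma(1-b-n+L)\Gamma(c-b-m+1+L)\Gamma(L+1)}.$$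 (B.2) If $n<m$, then $${}_3F_2(a,b,-n;c,m-n|1)=\frac{(-1)^n\Gamma(a+n-m+1)\Gamma(c)\Gamma(m-n)}{\Gamma(c-a)\Gamma(a)}\sum_{L=0}^{m-1}\frac{(-1)^L\,\Gamma(c-a+L)\Gamma(1+b-m+n+L)}{\Gamma(m-L)\Gamma(b-m+1+L)\Gamma(c+n-m+1+L)\Gamma(L+1)}.$$ (B.3) $${}_3F_2(a,-n,b;c,a-c+b-n+m|1)=\frac{\Gamma(c-b+n-m+1)\Gamma(c-a-b-m+1)\Gamma(m)\Gamma(c)}{\Gamma(n+1+c-a-b-m)\Gamma(b)\Gamma(c-b)}\sum_{L=0}^{m-1}\frac{(-1)^L\,\Gamma(b+L)\Gamma(1-a+c-m+n+L)}{\Gamma(m-L)\Gamma(c-a-m+1+L)\Gamma(c+n-m+1+L)\Gamma(L+1)}.$$ (B.4) $${}_3F_2(a,1,b;n+1,c|1)=\frac{\Gamma(a-n)\Gamma(b-n)\Gamma(n+1)\Gamma(c)\Gamma(c-a-b+n)}{\Gamma(b)\Gamma(c-b)\Gamma(a)\Gamma(c-a)}+\frac{\Gamma(1-b)\Gamma(n+1)\Gamma(c)}{\Gamma(a)}\sum_{L=0}^{n-1}\frac{(-1)^L\,\Gamma(a-1-L)}{\Gamma(c-1-L)\Gamma(n-L)\Gamma(2-b+L)}.$$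 (B.5) $${}_3F_2(a,b,n;n+1,c|1)=\frac{\Gamma(b-n)\Gamma(n+1)\Gamma(c)\Gamma(c-a-b+1)}{\Gamma(a)\Gamma(c-a)}\sum_{L=0}^{n-1}\frac{(-1)^L\,\Gamma(a-1-L)}{\Gamma(c-b-L)\Gamma(n-L)\Gamma(b+1+L-n)}+\frac{\Gamma(a-n)\Gamma(1-b)\Gamma(n+1)\Gamma(c)}{\Gamma(n+1-b)\Gamma(c-n)\Gamma(a)}.$$ (B.6) $${}_3F_2(1,a,b;c,a+b-c+n+1|1)=\frac{(a+b-c+n)\Gamma(a-c+1)\Gamma(n)\Gamma(c)}{\Gamma(c-b)}\sum_{L=0}^{n-1}\frac{(-1)^L\,\Gamma(c-b-1-L)}{\Gamma(c-1-L)\Gamma(n-L)\Gamma(a-c+2+L)}+\frac{\Gamma(a+b-c+n+1)\Gamma(c-b-n)\Gamma(c-a-n)\Gamma(n)\Gamma(c)}{\Gamma(c-a)\Gamma(a)\Gamma(c-b)\Gamma(b)}.$$ (B.7) $${}_3F_2(n,a,b;c,a+b-c+n+1|1)=\frac{\Gamma(a+b-c+n+1)\Gamma(c-a-n)\Gamma(c)}{\Gamma(c-b)\Gamma(b)}\sum_{L=0}^{n-1}\frac{(-1)^L\,\Gamma(c-b-1-L)}{\Gamma(a-L)\Gamma(n-L)\Gamma(c+1-a-n+L)}+\frac{(-1)^n\Gamma(a+b-c+n+1)\Gamma(c-b-n)\Gamma(c-a-n)\Gamma(c)}{\Gamma(c-a)\Gamma(c-n)\Gamma(c-b)\Gamma(a+b-c+1)}.$$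 (B.62) $${}_3F_2(a,b,c;a-n+1,c+b+n|1)=-\frac{\sin(\pi c)\,\Gamma(c+b+n)\Gamma(b-a+n)\Gamma(a-n+1)\Gamma(n)}{\pi\,\Gamma(b)\Gamma(a)\Gamma(b+n)}\sum_{L=0}^{n-1}\frac{\Gamma(1-c-n+L)\Gamma(b+L)}{\Gamma(L+1)\Gamma(b-a+1+L)}.$$ (B.63) $${}_3F_2(a,b,c;b+1,b-n+1|1)=-(-1)^n\,b\,\frac{\Gamma(b-c-n+2-a)\Gamma(b-n+1)\Gamma(n)\Gamma(1-c)}{\Gamma(a-b)\Gamma(b-a+1)\Gamma(b-c-n+1)\Gamma(1+b-c)}\sum_{L=0}^{n-1}\frac{\Gamma(a-b+L)\Gamma(b-c-n+1+L)}{\Gamma(L+1)\Gamma(2-c-n+L)}.$$ (B.64) $${}_3F_2(a,b,1;c,b-n+1|1)=\frac{(c-1)(n-b)\Gamma(n)\Gamma(1+b-c)}{\Gamma(n+1-c+a)\Gamma(b)}\sum_{L=0}^{n-1}\frac{\Gamma(a+L+1-c)\Gamma(b-n+L)}{\Gamma(L+1)\Gamma(b-c-n+2+L)}.$$ -/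

import Mathlib

open Complex (Gamma)

/-- `k`-th term `(a)_k (b)_k (c)_k / ((e)_k (f)_k k!)` of the series `₃F₂(a, b, c; e, f | 1)`. -/
noncomputable def hyp3F2Term (a b c e f : ℂ) (k : ℕ) : ℂ :=
  ((ascPochhammer ℂ k).eval a * (ascPochhammer ℂ k).eval b * (ascPochhammer ℂ k).eval c) /
    ((ascPochhammer ℂ k).eval e * (ascPochhammer ℂ k).eval f * (k.factorial : ℂ))

/-- `z` is not one of `0, -1, -2, …`, i.e. `z` is not a pole of the gamma function. -/
def NotNonposInt (z : ℂ) : Prop := ∀ k : ℕ, z ≠ -(k : ℂ)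

/-- `v` is the value of the analytically continued function `₃F₂(a, b, c; e, f | 1)`.

Write `s = e + f - a - b - c` for the excess. As a function of the five parameters the series
converges and is analytic for `0 < re s`, `e` and `f` not in `{0, -1, -2, …}`, and it continues to a
unique analytic function on the (connected) set of parameters where none of `e`, `f`, `s` is in
`{0, -1, -2, …}`. Its value is described here by continuation along a complex line through the
parameter point, with direction `(da, db, dc, de, df)`, along which the excess is `s + t`:
`F` is analytic on the whole part `U` of the line on which `e`, `f` and the excess avoid
`{0, -1, -2, …}` (an open connected set, which must contain the given point `t = 0`), and `F` is the
sum of the series wherever the excess has positive real part. The value does not depend on the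
line. For `0 < re s` it is just the sum of the series. -/
def Has3F2One (a b c e f v : ℂ) : Prop :=
  ∃ (da db dc de df : ℂ) (U : Set ℂ) (F : ℂ → ℂ),
    de + df - da - db - dc = 1 ∧
    U = {t : ℂ | NotNonposInt (e + t * de) ∧ NotNonposInt (f + t * df) ∧
      NotNonposInt (e + f - a - b - c + t)} ∧
    (0 : ℂ) ∈ U ∧
    DifferentiableOn ℂ F U ∧
    (∀ t ∈ U, 0 < (e + f - a - b - c + t).re →
      HasSum (hyp3F2Term (a + t * da) (b + t * db) (c + t * dc) (e + t * de) (f + t * df)) (F t)) ∧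
    F 0 = v

/-- With positive excess, the value is the sum of the convergent series. -/
theorem Has3F2One.hasSum {a b c e f v : ℂ} (h : Has3F2One a b c e f v)
    (hs : 0 < (e + f - a - b - c).re) : HasSum (hyp3F2Term a b c e f) v := by
  obtain ⟨da, db, dc, de, df, U, F, -, -, h0, -, hF, rfl⟩ := h
  simpa using hF 0 h0 (by simpa using hs)

/-! Divide the series by Γ(e)Γ(f). In the regularised terms `regTerm` the lower parameters enter
only through the entire function 1/Γ, so contiguous relations become identities that survive at its
zeros. Euler's limit for Γ shows that k^s (k + 1) times the term of index k + 1 tends to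
1/(Γ(a)Γ(b)Γ(c)), where s is the excess (`tendsto_regTerm_succ`). This gives summability for Re s >
0 and the boundary values at infinity of all telescoping sums. Gauss's theorem `hasSum_gaussTerm`
follows by iterating the relation between lower parameters c and c + 1.

The special ₃F₂ series have integer relations between their parameters and are reduced to Gauss sums
or finite sums in three ways.

Some are built directly from Gauss series. An upper a over a lower a - n contributes a polynomial in
k, which Vandermonde expands so that each piece is a Gauss series. An upper 1 over n + 1 gives a
tail of one Gauss series. An upper p + n + 1 over p + 1 gives the common tail of a combination of
Gauss series whose first p terms cancel.

Others are obtained by induction on n. A contiguous relation, valid termwise or after telescoping,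
links the series for n + 1 to the one for n with shifted parameters; a Gauss value or a boundary
term supplies the one new summand of the finite sum. This covers n over n + 1, upper 1 with natural
excess, upper n with excess one, b over b + 1 and b - n + 1, and b, 1 over b - n + 1.

The terminating series are finite double sums: expand one rising factorial, interchange the sums,
and evaluate the inner one by the finite Gauss sum `sum_choose_rising_rGamma`.

For the continued values, each closed form is holomorphic in one chosen parameter away from the
excluded points, so the complex line that moves this parameter alone witnesses `Has3F2One`. -/

open Filter Topology

/-! ### Rising factorials and the reciprocal gamma function -/

/-- The rising factorial `(x)_k = x (x + 1) ⋯ (x + k - 1)`. -/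
noncomputable def rising (x : ℂ) (k : ℕ) : ℂ := (ascPochhammer ℂ k).eval x

/-- The reciprocal gamma function, an entire function vanishing at the poles of `Γ`. -/
noncomputable def rGamma (z : ℂ) : ℂ := (Gamma z)⁻¹

@[simp] lemma rising_zero (x : ℂ) : rising x 0 = 1 := by simp [rising]

@[simp] lemma rising_one (x : ℂ) : rising x 1 = x := by simp [rising]

lemma rising_succ (x : ℂ) (k : ℕ) : rising x (k + 1) = rising x k * (x + k) := by
  simp [rising, ascPochhammer_succ_eval]

lemma rising_succ_left (x : ℂ) (k : ℕ) : rising x (k + 1) = x * rising (x + 1) k := by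
  induction k with
  | zero => simp
  | succ k ih => rw [rising_succ, ih, rising_succ (x + 1)]; push_cast; ring

lemma rising_add (x : ℂ) (k l : ℕ) : rising x (k + l) = rising x k * rising (x + k) l := by
  induction l with
  | zero => simp
  | succ l ih => rw [← add_assoc, rising_succ, ih, rising_succ]; push_cast; ring

lemma rising_mul_comm (x : ℂ) (k l : ℕ) :
    rising x k * rising (x + k) l = rising x l * rising (x + l) k := by
  rw [← rising_add, add_comm, rising_add]

lemma rising_one_left (k : ℕ) : rising 1 k = k.factorial := by
  simp [rising, ascPochhammer_eval_one]

lemma rising_natCast_succ (m k : ℕ) : rising ((m : ℂ) + 1) k * m.factorial = (m + k).factorial := by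
  have h := rising_add 1 m k
  rw [rising_one_left, rising_one_left, add_comm (1 : ℂ)] at h
  rw [h, mul_comm]

lemma rising_eq_prod (x : ℂ) (k : ℕ) : rising x k = ∏ j ∈ Finset.range k, (x + j) := by
  induction k with
  | zero => simp
  | succ k ih => rw [rising_succ, ih, Finset.prod_range_succ]

lemma rising_reflect (x : ℂ) (k : ℕ) : rising x k = (-1) ^ k * rising (1 - x - k) k := by
  induction k generalizing x with
  | zero => simp
  | succ k ih =>
    rw [rising_succ_left, ih, rising_succ, pow_succ]
    have : 1 - (x + 1) - (k : ℂ) = 1 - x - (k + 1 : ℕ) := by push_cast; ring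
    rw [this]; push_cast; ring

lemma rising_ne_zero {x : ℂ} (k : ℕ) (hx : ∀ j < k, x ≠ -(j : ℂ)) : rising x k ≠ 0 := by
  rw [rising_eq_prod, Finset.prod_ne_zero_iff]
  intro j hj h
  exact hx j (Finset.mem_range.1 hj) (eq_neg_of_add_eq_zero_left h)

lemma NotNonposInt.rising_ne_zero {x : ℂ} (hx : NotNonposInt x) (k : ℕ) : rising x k ≠ 0 :=
  _root_.rising_ne_zero k fun j _ => hx j

lemma NotNonposInt.gamma_ne_zero {x : ℂ} (hx : NotNonposInt x) : Gamma x ≠ 0 :=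
  Complex.Gamma_ne_zero hx

lemma NotNonposInt.rGamma_ne_zero {x : ℂ} (hx : NotNonposInt x) : rGamma x ≠ 0 :=
  inv_ne_zero hx.gamma_ne_zero

lemma NotNonposInt.add_nat {x : ℂ} (hx : NotNonposInt x) (k : ℕ) : NotNonposInt (x + k) := by
  intro j h
  apply hx (j + k)
  push_cast
  linear_combination h

lemma NotNonposInt.ne_zero {x : ℂ} (hx : NotNonposInt x) : x ≠ 0 := by
  simpa using hx 0

lemma notNonposInt_of_re_pos {x : ℂ} (hx : 0 < x.re) : NotNonposInt x := by
  rintro k rfl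
  simp at hx
  exact absurd hx (by have := Nat.cast_nonneg (α := ℝ) k; linarith)

lemma rGamma_eq_mul (z : ℂ) : rGamma z = z * rGamma (z + 1) :=
  Complex.one_div_Gamma_eq_self_mul_one_div_Gamma_add_one z

/-- Valid at the poles of Γ as well, unlike `NotNonposInt.gamma_add_nat`; shifts of lower parameters
in this form need no hypothesis. -/
lemma rGamma_eq_rising_mul (z : ℂ) (k : ℕ) : rGamma z = rising z k * rGamma (z + k) := by
  induction k with
  | zero => simp
  | succ k ih =>
    rw [ih, rising_succ, rGamma_eq_mul (z + k)]; push_cast; ring_nf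

lemma rGamma_nat_succ (k : ℕ) : rGamma ((k : ℂ) + 1) = (k.factorial : ℂ)⁻¹ := by
  rw [rGamma, Complex.Gamma_nat_eq_factorial]

lemma NotNonposInt.gamma_mul_rGamma {z : ℂ} (hz : NotNonposInt z) : Gamma z * rGamma z = 1 :=
  mul_inv_cancel₀ hz.gamma_ne_zero

/-- `Γ(z + k) = (z)_k Γ(z)` away from the poles. -/
lemma NotNonposInt.gamma_add_nat {z : ℂ} (hz : NotNonposInt z) (k : ℕ) :
    Gamma (z + k) = rising z k * Gamma z := by
  have h := rGamma_eq_rising_mul z k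
  have h1 := hz.gamma_ne_zero
  have h2 := (hz.add_nat k).gamma_ne_zero
  simp only [rGamma] at h
  field_simp at h
  rw [h]; ring

lemma NotNonposInt.rGamma_add_nat {z : ℂ} (hz : NotNonposInt z) (k : ℕ) :
    rGamma (z + k) = rGamma z / rising z k := by
  rw [rGamma_eq_rising_mul z k]
  field_simp [hz.rising_ne_zero k]

lemma differentiable_rGamma : Differentiable ℂ rGamma := Complex.differentiable_one_div_Gamma

/-! ### Finite Vandermonde and Gauss sums -/

/-- Pascal's rule for summands that depend on both L and N - L; the inductions on N for binomial
sums start from it. -/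
lemma sum_range_choose_succ (f : ℕ → ℕ → ℂ) (N : ℕ) :
    ∑ L ∈ Finset.range (N + 1 + 1), ((N + 1).choose L : ℂ) * f L (N + 1 - L) =
      ∑ L ∈ Finset.range (N + 1), (N.choose L : ℂ) * (f L (N - L + 1) + f (L + 1) (N - L)) := by
  have h := Finset.sum_antidiagonal_choose_succ_mul f N
  simp only [Finset.Nat.sum_antidiagonal_eq_sum_range_succ_mk] at h
  rw [h, ← Finset.sum_add_distrib]
  refine Finset.sum_congr rfl fun L hL => ?_
  rw [Nat.choose_symm (Nat.lt_succ_iff.1 (Finset.mem_range.1 hL))]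
  ring

/-- `(x + y)_N = ∑ C(N, L) (x)_L (y)_{N - L}`. -/
lemma rising_vandermonde (x y : ℂ) (N : ℕ) :
    rising (x + y) N =
      ∑ L ∈ Finset.range (N + 1), (N.choose L : ℂ) * (rising x L * rising y (N - L)) := by
  induction N with
  | zero => simp
  | succ N ih =>
    rw [sum_range_choose_succ fun i j => rising x i * rising y j, rising_succ, ih, Finset.sum_mul]
    refine Finset.sum_congr rfl fun L hL => ?_
    have hL' := Nat.lt_succ_iff.1 (Finset.mem_range.1 hL)
    rw [rising_succ, rising_succ, Nat.cast_sub hL']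
    ring

/-- `∑ (-1)^L C(N, L) (x)_L / Γ(y + L) = (y - x)_N / Γ(y + N)`. -/
lemma sum_choose_rising_rGamma (x y : ℂ) (N : ℕ) :
    ∑ L ∈ Finset.range (N + 1), (N.choose L : ℂ) * ((-1) ^ L * rising x L * rGamma (y + L)) =
      rising (y - x) N * rGamma (y + N) := by
  induction N generalizing y with
  | zero => simp
  | succ N ih =>
    rw [sum_range_choose_succ fun i _ => (-1) ^ i * rising x i * rGamma (y + i), rising_succ_left,
      show y - x + 1 = y + 1 - x by ring, show y + (N + 1 : ℕ) = y + 1 + N by push_cast; ring,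
      mul_assoc, ← ih, Finset.mul_sum]
    refine Finset.sum_congr rfl fun L _ => ?_
    -- Neighbouring summands combine by 1/Γ(y + L) - (x + L)/Γ(y + 1 + L) = (y - x)/Γ(y + 1 + L).
    rw [rising_succ, rGamma_eq_mul (y + L), pow_succ]
    push_cast
    rw [show y + L + 1 = y + 1 + L by ring, show y + (L + 1) = y + 1 + L by ring]
    ring

/-! ### Growth of the terms and convergence -/

/-- `(x)_{k+1} / (k^x k!) → 1 / Γ(x)`. -/
lemma tendsto_rising_succ (x : ℂ) :
    Tendsto (fun k : ℕ => rising x (k + 1) / ((k : ℂ) ^ x * k.factorial)) atTop (𝓝 (rGamma x)) := by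
  have hseq : ∀ k, rising x (k + 1) / ((k : ℂ) ^ x * k.factorial) = (Complex.GammaSeq x k)⁻¹ := by
    intro k
    rw [Complex.GammaSeq, inv_div, rising_eq_prod]
  simp only [hseq]
  by_cases hx : NotNonposInt x
  · exact (Complex.GammaSeq_tendsto_Gamma x).inv₀ hx.gamma_ne_zero
  -- At a pole -p the rising factorial contains the factor 0 as soon as k ≥ p, in agreement with
  -- 1/Γ(-p) = 0.
  · simp only [NotNonposInt, not_forall, not_not] at hx
    obtain ⟨p, rfl⟩ := hx
    have h0 : rGamma (-(p : ℂ)) = 0 := by simp [rGamma, Complex.Gamma_neg_nat_eq_zero]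
    rw [h0]
    refine tendsto_const_nhds.congr' ?_
    filter_upwards [eventually_ge_atTop p] with k hk
    rw [← hseq, rising_eq_prod, Finset.prod_eq_zero (Finset.mem_range.2 (Nat.lt_succ_of_le hk))
      (by simp), zero_div]

/-- `k^z k! / Γ(z + k + 1) → 1`. -/
lemma tendsto_rGamma_succ (z : ℂ) :
    Tendsto (fun k : ℕ => rGamma (z + (k + 1 : ℕ)) * ((k : ℂ) ^ z * k.factorial)) atTop (𝓝 1) := by
  -- Away from the poles, Γ(z + k + 1) = (z)_{k+1} Γ(z) reduces the claim to Euler's limit. The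
  -- poles are then reached by descending from some z + p to the right of them with the functional
  -- equation.
  have main : ∀ z : ℂ, NotNonposInt z →
    Tendsto (fun k : ℕ => rGamma (z + (k + 1 : ℕ)) * ((k : ℂ) ^ z * k.factorial)) atTop (𝓝 1) := by
    intro z hz
    have h := ((tendsto_rising_succ z).inv₀ hz.rGamma_ne_zero).const_mul (rGamma z)
    rw [mul_inv_cancel₀ hz.rGamma_ne_zero] at h
    refine h.congr fun k => ?_
    rw [hz.rGamma_add_nat, inv_div]; ring
  obtain ⟨p, hp⟩ := exists_nat_gt (-z.re)
  have hp' : NotNonposInt (z + p) := notNonposInt_of_re_pos (by simp; linarith)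
  clear hp
  induction p generalizing z with
  | zero => exact main z (by simpa using hp')
  | succ p ih =>
    have h := ih (z + 1) (by convert hp' using 1; push_cast; ring)
    have h2 : Tendsto (fun k : ℕ => 1 + (z + 1) * (k : ℂ)⁻¹) atTop (𝓝 (1 + (z + 1) * 0)) :=
      tendsto_const_nhds.add (tendsto_const_nhds.mul (tendsto_inv_atTop_nhds_zero_nat (𝕜 := ℂ)))
    have h3 := h.mul h2
    rw [mul_zero, add_zero, mul_one] at h3
    refine h3.congr' ?_
    filter_upwards [eventually_ne_atTop 0] with k hk
    have hk' : (k : ℂ) ≠ 0 := Nat.cast_ne_zero.2 hk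
    rw [rGamma_eq_mul (z + (k + 1 : ℕ)), Complex.cpow_add _ _ hk', Complex.cpow_one,
      show z + 1 + (k + 1 : ℕ) = z + (k + 1 : ℕ) + 1 by ring]
    push_cast
    field_simp
    ring

/-- The regularised `₃F₂` term `(a)_k (b)_k (c)_k / (Γ(e + k) Γ(f + k) k!)`. -/
noncomputable def regTerm (a b c e f : ℂ) (k : ℕ) : ℂ :=
  rising a k * rising b k * rising c k * rGamma (e + k) * rGamma (f + k) * (k.factorial : ℂ)⁻¹

/-- The powers k^a, k^b, k^c of the numerator and k^e, k^f of the denominator combine to the excess,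
and the factorials leave the factor k + 1. The index k + 1 is the one in Euler's limit. -/
lemma tendsto_regTerm_succ (a b c e f : ℂ) :
    Tendsto (fun k : ℕ => (k : ℂ) ^ (e + f - a - b - c) * (k + 1) * regTerm a b c e f (k + 1))
      atTop (𝓝 (rGamma a * rGamma b * rGamma c)) := by
  have h := (((tendsto_rising_succ a).mul (tendsto_rising_succ b)).mul
    (tendsto_rising_succ c)).mul ((tendsto_rGamma_succ e).mul (tendsto_rGamma_succ f))
  rw [mul_one, mul_one] at h
  refine h.congr' ?_
  filter_upwards [eventually_ne_atTop 0] with k hk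
  have hk' : (k : ℂ) ≠ 0 := Nat.cast_ne_zero.2 hk
  have hf : (k.factorial : ℂ) ≠ 0 := Nat.cast_ne_zero.2 k.factorial_ne_zero
  have hk1 : (k : ℂ) + 1 ≠ 0 := Nat.cast_add_one_ne_zero k
  have hp : ∀ z : ℂ, (k : ℂ) ^ z ≠ 0 := fun z => by simp [Complex.cpow_eq_zero_iff, hk']
  rw [regTerm, Nat.factorial_succ, Complex.cpow_sub _ _ hk', Complex.cpow_sub _ _ hk',
    Complex.cpow_sub _ _ hk', Complex.cpow_add _ _ hk']
  push_cast
  have h1 := hp a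
  have h2 := hp b
  have h3 := hp c
  field_simp

lemma isBigO_regTerm_succ (a b c e f : ℂ) :
    (fun k : ℕ => regTerm a b c e f (k + 1)) =O[atTop]
      fun k : ℕ => (k : ℝ) ^ (-((e + f - a - b - c).re + 1)) := by
  set s := e + f - a - b - c with hs_def
  have h := (tendsto_regTerm_succ a b c e f).isBigO_one ℝ
  have hmain : (fun k : ℕ => regTerm a b c e f (k + 1)) =ᶠ[atTop] fun k : ℕ =>
      ((k : ℂ) ^ (-s) * (k + 1 : ℂ)⁻¹) *
        ((k : ℂ) ^ (e + f - a - b - c) * (k + 1) * regTerm a b c e f (k + 1)) := by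
    filter_upwards [eventually_ne_atTop 0] with k hk
    have hk' : (k : ℂ) ≠ 0 := Nat.cast_ne_zero.2 hk
    have hk1 : (k : ℂ) + 1 ≠ 0 := Nat.cast_add_one_ne_zero k
    have hp : (k : ℂ) ^ s ≠ 0 := by simp [Complex.cpow_eq_zero_iff, hk']
    rw [← hs_def, Complex.cpow_neg]
    field_simp
  refine hmain.trans_isBigO ?_
  have h1 : (fun k : ℕ => ((k : ℂ) ^ (-s) * (k + 1 : ℂ)⁻¹)) =O[atTop]
      fun k : ℕ => (k : ℝ) ^ (-(s.re + 1)) := by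
    refine Asymptotics.IsBigO.of_bound 1 ?_
    filter_upwards [eventually_gt_atTop 0] with k hk
    have hk0 : (0 : ℝ) < k := Nat.cast_pos.2 hk
    rw [norm_mul, Complex.norm_natCast_cpow_of_pos hk, norm_inv, Complex.neg_re, one_mul,
      Real.norm_of_nonneg (by positivity), show -(s.re + 1) = -s.re + -1 by ring,
      Real.rpow_add hk0, Real.rpow_neg_one]
    gcongr
    rw [show (k : ℂ) + 1 = ((k + 1 : ℕ) : ℂ) by push_cast; rfl, Complex.norm_natCast]
    push_cast; linarith
  simpa using h1.mul h

lemma summable_regTerm {a b c e f : ℂ} (hs : 0 < (e + f - a - b - c).re) :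
    Summable (regTerm a b c e f) := by
  rw [← summable_nat_add_iff 1]
  exact summable_of_isBigO_nat (Real.summable_nat_rpow.2 (by linarith))
    (isBigO_regTerm_succ a b c e f)

/-- The terms vanish in the limit already for Re s > -1, which matters because a boundary term can
have smaller excess than the series it closes. -/
lemma tendsto_regTerm_zero {a b c e f : ℂ} (hs : -1 < (e + f - a - b - c).re) :
    Tendsto (regTerm a b c e f) atTop (𝓝 0) := by
  rw [← tendsto_add_atTop_iff_nat 1]
  exact (isBigO_regTerm_succ a b c e f).trans_tendsto
    ((tendsto_rpow_neg_atTop (by linarith)).comp (tendsto_natCast_atTop_atTop (R := ℝ)))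

/-- When the excess has positive real part, `k` times the `k`-th term tends to zero. -/
lemma tendsto_mul_regTerm {a b c e f : ℂ} (hs : 0 < (e + f - a - b - c).re) :
    Tendsto (fun k : ℕ => (k : ℂ) * regTerm a b c e f k) atTop (𝓝 0) := by
  rw [← tendsto_add_atTop_iff_nat 1]
  set s := e + f - a - b - c with hs_def
  have hz : Tendsto (fun k : ℕ => (k : ℂ) ^ (-s)) atTop (𝓝 0) := by
    rw [tendsto_zero_iff_norm_tendsto_zero]
    have := (tendsto_rpow_neg_atTop hs).comp (tendsto_natCast_atTop_atTop (R := ℝ))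
    refine this.congr' ?_
    filter_upwards [eventually_gt_atTop 0] with k hk
    simp [Complex.norm_natCast_cpow_of_pos hk]
  have h := hz.mul (tendsto_regTerm_succ a b c e f)
  rw [zero_mul] at h
  refine h.congr' ?_
  filter_upwards [eventually_ne_atTop 0] with k hk
  have hk' : (k : ℂ) ≠ 0 := Nat.cast_ne_zero.2 hk
  have hp : (k : ℂ) ^ s ≠ 0 := by simp [Complex.cpow_eq_zero_iff, hk']
  rw [← hs_def, Complex.cpow_neg]
  push_cast
  field_simp

/-- When the excess is `1`, `k ^ 2` times the `k`-th term has the limit `1 / (Γ(a) Γ(b) Γ(c))`. -/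
lemma tendsto_mul_mul_regTerm {a b c e f : ℂ} (hs : e + f - a - b - c = 1) :
    Tendsto (fun k : ℕ => (k : ℂ) * (k + 1) * regTerm a b c e f (k + 1)) atTop
      (𝓝 (rGamma a * rGamma b * rGamma c)) := by
  simpa [hs] using tendsto_regTerm_succ a b c e f

lemma hyp3F2Term_eq_regTerm {a b c e f : ℂ} (he : NotNonposInt e) (hf : NotNonposInt f) (k : ℕ) :
    hyp3F2Term a b c e f k = Gamma e * Gamma f * regTerm a b c e f k := by
  rw [regTerm, he.rGamma_add_nat, hf.rGamma_add_nat]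
  have h1 := he.gamma_mul_rGamma
  have h2 := hf.gamma_mul_rGamma
  simp only [hyp3F2Term, ← rising.eq_1]
  calc _ = (Gamma e * rGamma e) * (Gamma f * rGamma f) * (rising a k * rising b k * rising c k /
        (rising e k * rising f k * k.factorial)) := by rw [h1, h2]; ring
    _ = _ := by ring

/-- A telescoping sum. -/
lemma hasSum_of_partial_sums {f v : ℕ → ℂ} {l : ℂ} (hf : Summable f)
    (h : ∀ N, ∑ k ∈ Finset.range N, f k = v N) (hv : Tendsto v atTop (𝓝 l)) : HasSum f l := by
  rw [hf.hasSum_iff_tendsto_nat]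
  simpa only [h] using hv

/-! ### Gauss's summation theorem -/

/-- The regularised Gauss term `(a)_k (b)_k / (Γ(c + k) k!)`. -/
noncomputable def gaussTerm (a b c : ℂ) (k : ℕ) : ℂ :=
  rising a k * rising b k * rGamma (c + k) * (k.factorial : ℂ)⁻¹

/-- The pair 1 over 1 cancels, so Gauss terms inherit the growth estimates. -/
lemma regTerm_one_one (a b c : ℂ) : regTerm a b 1 c 1 = gaussTerm a b c := by
  ext k
  have hf : (k.factorial : ℂ) ≠ 0 := Nat.cast_ne_zero.2 k.factorial_ne_zero
  rw [regTerm, gaussTerm, rising_one_left, add_comm (1 : ℂ), rGamma_nat_succ]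
  field_simp

lemma summable_gaussTerm {a b c : ℂ} (hs : 0 < (c - a - b).re) : Summable (gaussTerm a b c) := by
  rw [← regTerm_one_one]
  exact summable_regTerm (by convert hs using 2; ring)

lemma tendsto_mul_gaussTerm {a b c : ℂ} (hs : 0 < (c - a - b).re) :
    Tendsto (fun k : ℕ => (k : ℂ) * gaussTerm a b c k) atTop (𝓝 0) := by
  rw [← regTerm_one_one]
  exact tendsto_mul_regTerm (by convert hs using 2; ring)

/-- The termwise difference of the two sides telescopes to -N times the N-th Gauss term, which tends
to 0 for positive excess. -/
lemma tsum_gaussTerm_succ {a b c : ℂ} (hs : 0 < (c - a - b).re) :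
    (c - a - b) * ∑' k, gaussTerm a b c k =
      (c - a) * (c - b) * ∑' k, gaussTerm a b (c + 1) k := by
  have h1 := summable_gaussTerm hs
  have h2 : Summable (gaussTerm a b (c + 1)) :=
    summable_gaussTerm (by simp only [Complex.sub_re, Complex.add_re, Complex.one_re] at *; linarith)
  have h3 := (h1.mul_left (c - a - b)).sub (h2.mul_left ((c - a) * (c - b)))
  have h4 := hasSum_of_partial_sums (v := fun N => -((N : ℂ) * gaussTerm a b c N)) (l := 0) h3 ?_
    (by simpa using (tendsto_mul_gaussTerm hs).neg)
  · have h5 := ((h1.hasSum.mul_left (c - a - b)).sub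
      (h2.hasSum.mul_left ((c - a) * (c - b)))).unique h4
    linear_combination h5
  · intro N
    induction N with
    | zero => simp
    | succ N ih =>
      rw [Finset.sum_range_succ, ih]
      have hf : (N.factorial : ℂ) ≠ 0 := Nat.cast_ne_zero.2 N.factorial_ne_zero
      have hk1 : (N : ℂ) + 1 ≠ 0 := Nat.cast_add_one_ne_zero N
      simp only [gaussTerm, rising_succ, Nat.factorial_succ, rGamma_eq_mul (c + N)]
      push_cast
      rw [show c + 1 + N = c + N + 1 by ring, ← add_assoc]
      field_simp
      ring

lemma norm_rising_le (a : ℂ) (k : ℕ) : ‖rising a k‖ ≤ ∏ j ∈ Finset.range k, (‖a‖ + j) := by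
  rw [rising_eq_prod, norm_prod]
  refine Finset.prod_le_prod (fun _ _ => norm_nonneg _) fun j _ => ?_
  simpa using norm_add_le a j

lemma le_norm_rising {c : ℂ} {r : ℝ} (hr : 0 ≤ r) (hc : r ≤ c.re) (k : ℕ) :
    ∏ j ∈ Finset.range k, (r + j) ≤ ‖rising c k‖ := by
  rw [rising_eq_prod, norm_prod]
  refine Finset.prod_le_prod (fun _ _ => by positivity) fun j _ => ?_
  refine le_trans ?_ (Complex.re_le_norm _)
  simpa using hc

lemma rising_ofReal (r : ℝ) (k : ℕ) :
    rising (r : ℂ) k = ((∏ j ∈ Finset.range k, (r + j) : ℝ) : ℂ) := by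
  rw [rising_eq_prod]; push_cast; rfl

lemma tendsto_inv_rising_add_nat (c : ℂ) {k : ℕ} (hk : k ≠ 0) :
    Tendsto (fun N : ℕ => (rising (c + N) k)⁻¹) atTop (𝓝 0) := by
  have h : Tendsto (fun N : ℕ => ∏ j ∈ Finset.range k, (c + N + j)⁻¹) atTop
      (𝓝 (∏ _j ∈ Finset.range k, 0)) := by
    refine tendsto_finsetProd _ fun j _ => ?_
    have h1 := (tendsto_const_add_cobounded (c + j)).comp (tendsto_natCast_atTop_cobounded (α := ℂ))
    exact (tendsto_inv₀_cobounded.comp h1).congr fun N => by simp [add_right_comm]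
  rw [Finset.prod_const, Finset.card_range, zero_pow hk] at h
  refine h.congr fun N => ?_
  rw [rising_eq_prod, Finset.prod_inv_distrib]

/-- For large N this is the ordinary ₂F₁(a, b; c + N | 1), whose terms with k > 0 tend to 0.
Dominated convergence applies with the majorant ₂F₁(‖a‖, ‖b‖; r | 1), which converges because r = Re
c + M exceeds ‖a‖ + ‖b‖. -/
lemma tendsto_gamma_mul_tsum_gaussTerm (a b c : ℂ) :
    Tendsto (fun N : ℕ => Gamma (c + N) * ∑' k, gaussTerm a b (c + N) k) atTop (𝓝 1) := by
  obtain ⟨M, hM⟩ := exists_nat_gt (‖a‖ + ‖b‖ - c.re)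
  set r : ℝ := c.re + M with hr_def
  have hr : ‖a‖ + ‖b‖ < r := by rw [hr_def]; linarith
  have hr0 : 0 < r := lt_of_le_of_lt (by positivity) hr
  have hrn : NotNonposInt (r : ℂ) := notNonposInt_of_re_pos (by simpa using hr0)
  have hcn : ∀ N : ℕ, M ≤ N → r ≤ (c + N).re := fun N hN => by
    have : (M : ℝ) ≤ N := Nat.cast_le.2 hN
    simp only [Complex.add_re, Complex.natCast_re]; linarith
  have hterm : ∀ z : ℂ, NotNonposInt z → ∀ x y k, Gamma z * gaussTerm x y z k =
      rising x k * rising y k * (rising z k)⁻¹ * (k.factorial : ℂ)⁻¹ := fun z hz x y k => by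
    rw [gaussTerm, hz.rGamma_add_nat]
    linear_combination (rising x k * rising y k * (rising z k)⁻¹ * (k.factorial : ℂ)⁻¹) *
      hz.gamma_mul_rGamma
  have hsum : Summable fun k => ‖Gamma r * gaussTerm ‖a‖ ‖b‖ r k‖ :=
    ((summable_gaussTerm (a := (‖a‖ : ℂ)) (b := ‖b‖) (c := r)
      (by simp; linarith)).mul_left _).norm
  have hlim := tendsto_tsum_of_dominated_convergence (𝓕 := atTop)
    (f := fun (N : ℕ) k => Gamma (c + N) * gaussTerm a b (c + N) k)
    (g := fun k => if k = 0 then (1 : ℂ) else 0) hsum ?_ ?_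
  · simpa only [tsum_ite_eq, tsum_mul_left] using hlim
  · intro k
    have h1 : Tendsto (fun N : ℕ => rising a k * rising b k * (rising (c + N) k)⁻¹ *
        (k.factorial : ℂ)⁻¹) atTop (𝓝 (if k = 0 then (1 : ℂ) else 0)) := by
      by_cases hk : k = 0
      · subst hk; simp
      · rw [if_neg hk]
        simpa using ((tendsto_inv_rising_add_nat c hk).const_mul (rising a k * rising b k)).mul_const
          (k.factorial : ℂ)⁻¹
    refine h1.congr' ?_
    filter_upwards [eventually_ge_atTop M] with N hN
    rw [hterm _ (notNonposInt_of_re_pos (hr0.trans_le (hcn N hN)))]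
  · filter_upwards [eventually_ge_atTop M] with N hN k
    rw [hterm _ (notNonposInt_of_re_pos (hr0.trans_le (hcn N hN))), hterm _ hrn, rising_ofReal,
      rising_ofReal, rising_ofReal, norm_mul, norm_mul, norm_mul, norm_mul, norm_mul, norm_mul,
      norm_inv, norm_inv (Complex.ofReal _), Complex.norm_of_nonneg, Complex.norm_of_nonneg,
      Complex.norm_of_nonneg]
    · have h3 : 0 < ∏ j ∈ Finset.range k, (r + j) := Finset.prod_pos fun j _ => by positivity
      have h4 := le_norm_rising hr0.le (hcn N hN) k
      gcongr
      · exact norm_rising_le a k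
      · exact norm_rising_le b k
    all_goals exact Finset.prod_nonneg fun j _ => by positivity

/-- **Gauss's summation theorem**, regularised. -/
theorem hasSum_gaussTerm {a b c : ℂ} (hs : 0 < (c - a - b).re) :
    HasSum (gaussTerm a b c) (Gamma (c - a - b) * rGamma (c - a) * rGamma (c - b)) := by
  have hiter : ∀ N : ℕ, rising (c - a - b) N * ∑' k, gaussTerm a b c k =
      rising (c - a) N * rising (c - b) N * ∑' k, gaussTerm a b (c + N) k := by
    intro N
    induction N with
    | zero => simp
    | succ N ih =>
      have h := tsum_gaussTerm_succ (a := a) (b := b) (c := c + N)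
        (by have := Nat.cast_nonneg (α := ℝ) N; simp at hs ⊢; linarith)
      rw [rising_succ, rising_succ, rising_succ]
      push_cast
      rw [← add_assoc]
      linear_combination (c - a - b + N) * ih + rising (c - a) N * rising (c - b) N * h
  have hL := (tendsto_rising_succ (c - a - b)).mul_const (∑' k, gaussTerm a b c k)
  -- The factors 1/Γ(c + k + 1) and Γ(c + k + 1) are inserted so that each part has a limit; they
  -- cancel for large k, and the powers of k on the two sides agree.
  have hR := ((tendsto_rising_succ (c - a)).mul (tendsto_rising_succ (c - b))).mul
    ((tendsto_rGamma_succ c).mul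
      ((tendsto_add_atTop_iff_nat 1).2 (tendsto_gamma_mul_tsum_gaussTerm a b c)))
  obtain ⟨M, hM⟩ := exists_nat_gt (-c.re)
  have heq := tendsto_nhds_unique_of_eventuallyEq hL hR ?_
  · have hn := (notNonposInt_of_re_pos hs).gamma_mul_rGamma
    have hval : ∑' k, gaussTerm a b c k =
        Gamma (c - a - b) * rGamma (c - a) * rGamma (c - b) := by
      linear_combination Gamma (c - a - b) * heq - (∑' k, gaussTerm a b c k) * hn
    rw [← hval]
    exact (summable_gaussTerm hs).hasSum
  · filter_upwards [eventually_ge_atTop M, eventually_ne_atTop 0] with k hk hk0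
    have hk' : (k : ℂ) ≠ 0 := Nat.cast_ne_zero.2 hk0
    have hf : (k.factorial : ℂ) ≠ 0 := Nat.cast_ne_zero.2 k.factorial_ne_zero
    have hp : ∀ z : ℂ, (k : ℂ) ^ z ≠ 0 := fun z => by simp [Complex.cpow_eq_zero_iff, hk']
    have hn : NotNonposInt (c + (k + 1 : ℕ)) := notNonposInt_of_re_pos (by
      have : (M : ℝ) ≤ k := Nat.cast_le.2 hk
      simp; linarith)
    have h := hiter (k + 1)
    have hg := hn.gamma_mul_rGamma
    rw [Complex.cpow_sub _ _ hk', Complex.cpow_sub _ _ hk', Complex.cpow_sub _ _ hk']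
    have h1 := hp a
    have h2 := hp b
    have h3 := hp c
    field_simp
    linear_combination h - rising (c - a) (k + 1) * rising (c - b) (k + 1) *
      (∑' k_1, gaussTerm a b (c + (k + 1 : ℕ)) k_1) * hg

-- From sums of series to analytic continuation

attribute [fun_prop] differentiable_rGamma

lemma hasSum_hyp3F2Term {a b c e f S : ℂ} (he : NotNonposInt e) (hf : NotNonposInt f)
    (h : HasSum (regTerm a b c e f) S) : HasSum (hyp3F2Term a b c e f) (Gamma e * Gamma f * S) := by
  simpa only [← hyp3F2Term_eq_regTerm he hf] using h.mul_left (Gamma e * Gamma f)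

/-- Continuation along the line that moves only the first lower parameter: it suffices that V is
holomorphic off the excluded points and sums the series for positive excess. The two variants that
follow move f, or move a in direction -1 so that the excess is again s + t. -/
lemma has3F2One_of_lower_left {a b c e f : ℂ} (V : ℂ → ℂ) (he : NotNonposInt e)
    (hf : NotNonposInt f) (hs : NotNonposInt (e + f - a - b - c))
    (hV : ∀ z, NotNonposInt z → NotNonposInt (z + f - a - b - c) → DifferentiableAt ℂ V z)
    (hsum : ∀ z, NotNonposInt z → 0 < (z + f - a - b - c).re →
      HasSum (hyp3F2Term a b c z f) (V z)) : Has3F2One a b c e f (V e) := by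
  refine ⟨0, 0, 0, 1, 0, _, fun t => V (e + t), by ring, rfl, by simpa using ⟨he, hf, hs⟩, ?_, ?_,
    by simp⟩
  · rintro t ⟨h1, -, h3⟩
    rw [mul_one] at h1
    rw [show e + f - a - b - c + t = e + t + f - a - b - c by ring] at h3
    have := hV _ h1 h3
    exact DifferentiableAt.differentiableWithinAt (by fun_prop)
  · rintro t ⟨h1, -, -⟩ h4
    rw [mul_one] at h1
    simpa using hsum _ h1 (by convert h4 using 2; ring)

lemma has3F2One_of_lower_right {a b c e f : ℂ} (V : ℂ → ℂ) (he : NotNonposInt e)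
    (hf : NotNonposInt f) (hs : NotNonposInt (e + f - a - b - c))
    (hV : ∀ z, NotNonposInt z → NotNonposInt (e + z - a - b - c) → DifferentiableAt ℂ V z)
    (hsum : ∀ z, NotNonposInt z → 0 < (e + z - a - b - c).re →
      HasSum (hyp3F2Term a b c e z) (V z)) : Has3F2One a b c e f (V f) := by
  refine ⟨0, 0, 0, 0, 1, _, fun t => V (f + t), by ring, rfl, by simpa using ⟨he, hf, hs⟩, ?_, ?_,
    by simp⟩
  · rintro t ⟨-, h1, h3⟩
    rw [mul_one] at h1
    rw [show e + f - a - b - c + t = e + (f + t) - a - b - c by ring] at h3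
    have := hV _ h1 h3
    exact DifferentiableAt.differentiableWithinAt (by fun_prop)
  · rintro t ⟨-, h1, -⟩ h4
    rw [mul_one] at h1
    simpa using hsum _ h1 (by convert h4 using 2; ring)

lemma has3F2One_of_upper {a b c e f : ℂ} (V : ℂ → ℂ) (he : NotNonposInt e)
    (hf : NotNonposInt f) (hs : NotNonposInt (e + f - a - b - c))
    (hV : ∀ z, NotNonposInt (e + f - z - b - c) → DifferentiableAt ℂ V z)
    (hsum : ∀ z, 0 < (e + f - z - b - c).re →
      HasSum (hyp3F2Term z b c e f) (V z)) : Has3F2One a b c e f (V a) := by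
  refine ⟨-1, 0, 0, 0, 0, _, fun t => V (a - t), by ring, rfl, by simpa using ⟨he, hf, hs⟩, ?_, ?_,
    by simp⟩
  · rintro t ⟨-, -, h3⟩
    rw [show e + f - a - b - c + t = e + f - (a - t) - b - c by ring] at h3
    have := hV _ h3
    exact DifferentiableAt.differentiableWithinAt (by fun_prop)
  · rintro t - h4
    simpa [← sub_eq_add_neg] using hsum (a - t) (by convert h4 using 2; ring)

lemma NotNonposInt.differentiableAt_gamma_add {z w : ℂ} (h : NotNonposInt (z + w)) :
    DifferentiableAt ℂ (fun x => Gamma (x + w)) z :=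
  (Complex.differentiableAt_Gamma _ h).comp z (by fun_prop)

/-! ### Upper parameter `1` over the lower parameter `n + 1` -/

lemma notNonposInt_natCast_succ (n : ℕ) : NotNonposInt ((n : ℂ) + 1) :=
  notNonposInt_of_re_pos (by simp; positivity)

/-- Since (1)_k / (k! Γ(n + 1 + k)) = 1/(n + k)!, the series is a constant times the tail, from
index n on, of the Gauss series with parameters a - n, b - n; c - n. -/
lemma hasSum_regTerm_one_natCast {n : ℕ} {a b c : ℂ} (ha : NotNonposInt (a - n))
    (hb : NotNonposInt (b - n)) (hs : 0 < (c - a - b + n).re) :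
    HasSum (regTerm a 1 b (n + 1) c) ((rising (a - n) n * rising (b - n) n)⁻¹ *
      (Gamma (c - a - b + n) * rGamma (c - a) * rGamma (c - b) -
        ∑ j ∈ Finset.range n, gaussTerm (a - n) (b - n) (c - n) j)) := by
  have h := hasSum_gaussTerm (a := a - n) (b := b - n) (c := c - n)
    (by convert hs using 2; ring)
  rw [← hasSum_nat_add_iff' n] at h
  have h2 := h.mul_left (rising (a - n) n * rising (b - n) n)⁻¹
  have e1 : c - n - (a - n) - (b - n) = c - a - b + n := by ring
  have e2 : c - n - (a - n) = c - a := by ring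
  have e3 : c - n - (b - n) = c - b := by ring
  rw [e1, e2, e3] at h2
  refine h2.congr_fun ?_
  intro k
  have h3 := ha.rising_ne_zero n
  have h4 := hb.rising_ne_zero n
  have h5 : (k.factorial : ℂ) ≠ 0 := Nat.cast_ne_zero.2 k.factorial_ne_zero
  rw [gaussTerm, regTerm, add_comm k n, rising_add, rising_add, sub_add_cancel, sub_add_cancel,
    rising_one_left, show (n : ℂ) + 1 + k = (n + k : ℕ) + 1 by push_cast; ring, rGamma_nat_succ,
    show c - n + (n + k : ℕ) = c + k by push_cast; ring]
  field_simp

lemma has3F2One_one_natCast_succ {n : ℕ} {a b c : ℂ} (hn : 0 < n) (hc : NotNonposInt c)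
    (hs : NotNonposInt (c - a - b + n)) (ha : NotNonposInt (a - n)) (hb : NotNonposInt (b - n))
    (hb1 : NotNonposInt (1 - b)) : Has3F2One a 1 b (n + 1) c
        (Gamma (a - n) * Gamma (b - n) * Gamma (n + 1) * Gamma c * Gamma (-b + c - a + n) /
            (Gamma b * Gamma (c - b) * Gamma a * Gamma (c - a)) +
          Gamma (-b + 1) *
            (∑ L ∈ Finset.range n,
              Gamma (-L + a - 1) * (-1) ^ L /
                (Gamma (c - 1 - L) * Gamma (n - L) * Gamma (-b + 2 + L))) *
            Gamma (n + 1) * Gamma c / Gamma a) := by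
  have hn1 := notNonposInt_natCast_succ n
  have key := has3F2One_of_lower_right (a := a) (b := 1) (c := b) (e := n + 1) (f := c)
    (fun c => Gamma (n + 1) * Gamma c * ((rising (a - n) n * rising (b - n) n)⁻¹ *
      (Gamma (c - a - b + n) * rGamma (c - a) * rGamma (c - b) -
        ∑ j ∈ Finset.range n, gaussTerm (a - n) (b - n) (c - n) j))) hn1 hc
    (by convert hs using 1; ring) ?_ ?_
  · convert key using 1
    have hna : Gamma a = rising (a - n) n * Gamma (a - n) := by
      simpa using ha.gamma_add_nat n
    have hnb : Gamma b = rising (b - n) n * Gamma (b - n) := by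
      simpa using hb.gamma_add_nat n
    have h1 := ha.rising_ne_zero n
    have h2 := hb.rising_ne_zero n
    have h3 := ha.gamma_ne_zero
    have h4 := hb.gamma_ne_zero
    have hsum : Gamma (-b + 1) * (∑ L ∈ Finset.range n, Gamma (-L + a - 1) * (-1) ^ L /
        (Gamma (c - 1 - L) * Gamma (n - L) * Gamma (-b + 2 + L))) / Gamma a =
        -((rising (a - n) n * rising (b - n) n)⁻¹ *
          ∑ j ∈ Finset.range n, gaussTerm (a - n) (b - n) (c - n) j) := by
      -- The head removed from the Gauss series is read backwards, j = n - 1 - L.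
      rw [← Finset.sum_range_reflect (gaussTerm _ _ _), Finset.mul_sum, Finset.mul_sum,
        Finset.sum_div, ← Finset.sum_neg_distrib]
      refine Finset.sum_congr rfl fun L hL => ?_
      obtain ⟨j, rfl⟩ : ∃ j, n = L + j + 1 :=
        ⟨n - 1 - L, by have := Finset.mem_range.1 hL; omega⟩
      have hj : L + j + 1 - 1 - L = j := by omega
      have hx : NotNonposInt (a - 1 - L) := by
        have := ha.add_nat j
        convert this using 1; push_cast; ring
      have f1 : rising (a - (L + j + 1 : ℕ)) (L + j + 1) =
          rising (a - (L + j + 1 : ℕ)) j * rising (a - 1 - L) (L + 1) := by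
        rw [show L + j + 1 = j + (L + 1) by ring, rising_add]; congr 2; push_cast; ring
      have f2 : rising (b - (L + j + 1 : ℕ)) (L + j + 1) =
          rising (b - (L + j + 1 : ℕ)) j * ((-1) ^ (L + 1) * rising (1 - b) (L + 1)) := by
        rw [show L + j + 1 = j + (L + 1) by ring, rising_add, rising_reflect (_ + (j : ℂ)) (L + 1)]
        congr 3; push_cast; ring
      have f3 : Gamma a = rising (a - 1 - L) (L + 1) * Gamma (a - 1 - L) := by
        rw [← hx.gamma_add_nat]; congr 1; push_cast; ring
      have f4 : Gamma (-b + 2 + L) = rising (1 - b) (L + 1) * Gamma (1 - b) := by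
        rw [← hb1.gamma_add_nat]; congr 1; push_cast; ring
      have f5 : Gamma ((L + j + 1 : ℕ) - (L : ℂ)) = j.factorial := by
        rw [← Complex.Gamma_nat_eq_factorial]; congr 1; push_cast; ring
      have f6 : (j.factorial : ℂ) ≠ 0 := Nat.cast_ne_zero.2 j.factorial_ne_zero
      have f7 : ((-1 : ℂ) ^ L) ^ 2 = 1 := by rw [← pow_mul, mul_comm, pow_mul]; norm_num
      have g1 := ha.rising_ne_zero j
      have g2 := hb.rising_ne_zero j
      have g3 := hx.rising_ne_zero (L + 1)
      have g4 := hb1.rising_ne_zero (L + 1)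
      have g5 := hx.gamma_ne_zero
      have g6 := hb1.gamma_ne_zero
      rw [hj, gaussTerm, f1, f2, f3, f4, f5, rGamma, pow_succ,
        show c - (L + j + 1 : ℕ) + j = c - 1 - L by push_cast; ring,
        show -(L : ℂ) + a - 1 = a - 1 - L by ring, show -b + 1 = 1 - b by ring]
      field_simp
      linear_combination (Gamma (c - 1 - L))⁻¹ * f7
    have e1 : -b + c - a + n = c - a - b + n := by ring
    rw [e1]
    simp only [rGamma]
    have hfirst : Gamma (a - n) * Gamma (b - n) / (Gamma b * Gamma a) =
        (rising (a - n) n * rising (b - n) n)⁻¹ := by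
      rw [hna, hnb]; field_simp
    linear_combination (Gamma (n + 1) * Gamma c) * hsum +
      (Gamma (n + 1) * Gamma c * Gamma (c - a - b + n) * (Gamma (c - a))⁻¹ * (Gamma (c - b))⁻¹) *
        hfirst
  · intro z h1 h2
    have h3 := (Complex.differentiableAt_Gamma z h1)
    have h4 := NotNonposInt.differentiableAt_gamma_add (z := z) (w := - a - b + n) (by convert h2 using 1; ring)
    have h5 : ∀ z, z - a - b + n = z + (- a - b + n) := fun z => by ring
    simp only [gaussTerm, h5]
    fun_prop
  · intro z h1 h2
    exact hasSum_hyp3F2Term hn1 h1 (hasSum_regTerm_one_natCast ha hb (by convert h2 using 2; ring))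

/-! ### Upper parameter `n` over the lower parameter `n + 1` -/

lemma rising_mul_rGamma_succ {x : ℂ} {k : ℕ} (h : x + k ≠ 0) :
    rising x k * rGamma (x + 1 + k) = rGamma x * (x + k)⁻¹ := by
  rw [rGamma_eq_rising_mul x k, rGamma_eq_mul (x + k), show x + k + 1 = x + 1 + k by ring]
  field_simp

lemma NotNonposInt.add_nat_ne_zero {x : ℂ} (hx : NotNonposInt x) (k : ℕ) : x + k ≠ 0 :=
  (hx.add_nat k).ne_zero

lemma HasSum.of_eq {f g : ℕ → ℂ} {s t : ℂ} (h : HasSum f s) (hf : ∀ k, g k = f k) (hs : t = s) :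
    HasSum g t := by
  rwa [hs, funext hf]

lemma hasSum_regTerm_zero_left (a b c f : ℂ) :
    HasSum (regTerm 0 a b c f) (rGamma c * rGamma f) := by
  convert hasSum_single (f := regTerm 0 a b c f) 0 ?_ using 1
  · simp [regTerm]
  · intro k hk
    obtain ⟨j, rfl⟩ := Nat.exists_eq_succ_of_ne_zero hk
    simp [regTerm, rising_succ_left]

lemma regTerm_comm_right (a b c e f : ℂ) : regTerm a b c e f = regTerm c a b e f := by
  ext k; simp only [regTerm]; ring

/-- The quotient of (n)_k by (n + 1)_k is n/(n + k). Subtracting the Gauss term leaves the numerator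
n(b + j) - (b - 1)(n + 1 + j) = (j + 1)(n + 1 - b), and the factor j + 1 turns (j + 1)! into j!. The
difference is thus a term of index j with n, a and c raised by one. -/
lemma factorial_mul_regTerm_natCast_succ (n : ℕ) (a b c : ℂ) (j : ℕ) :
    n.factorial * regTerm (a - 1) b n (n + 1) (c - 1) (j + 1) - gaussTerm (a - 1) (b - 1) (c - 1) (j + 1) =
      (a - 1) * (n + 1 - b) * n.factorial * regTerm a b (n + 1) (n + 1 + 1) c j := by
  have hj : (j : ℂ) + 1 ≠ 0 := Nat.cast_add_one_ne_zero j
  have hf : (j.factorial : ℂ) ≠ 0 := Nat.cast_ne_zero.2 j.factorial_ne_zero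
  have hn : (n.factorial : ℂ) ≠ 0 := Nat.cast_ne_zero.2 n.factorial_ne_zero
  have hnj : (n : ℂ) + 1 + j ≠ 0 := (notNonposInt_natCast_succ n).add_nat_ne_zero j
  have h1 := rising_mul_rGamma_succ hnj
  rw [rGamma_nat_succ] at h1
  have h2 : rGamma ((n : ℂ) + 1 + (j + 1 : ℕ)) = rGamma ((n : ℂ) + 1 + 1 + j) := by
    congr 1; push_cast; ring
  simp only [regTerm, gaussTerm, h2, rising_succ_left, sub_add_cancel, Nat.factorial_succ,
    show c - 1 + (j + 1 : ℕ) = c + j by push_cast; ring]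
  have h3 : rising b (j + 1) = b * rising (b + 1) j := rising_succ_left b j
  have h4 : b * rising (b + 1) j = rising b j * (b + j) := by rw [← h3, rising_succ]
  push_cast
  rw [h4]
  field_simp
  field_simp at h1
  linear_combination ((a - 1) * rising a j * rising b j * rGamma (c + j) * (b - 1)) * h1

/-- For n = 0 only the term k = 0 survives. In the induction step the zeroth terms of the two series
cancel, so the index can be shifted; the Gauss value becomes the new summand L = 0 and the old
summands move from L to L + 1. -/
lemma hasSum_regTerm_natCast_natCast_succ (n : ℕ) {a b c : ℂ} (hs : 0 < (c - a - b + 1).re)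
    (ha : NotNonposInt (a - n)) (hb : NotNonposInt (b - n)) (hb1 : NotNonposInt (1 - b)) :
    HasSum (regTerm a b n (n + 1) c)
      (Gamma (b - n) * Gamma (c - a - b + 1) * rGamma a * rGamma (c - a) *
        (∑ L ∈ Finset.range n, (-1) ^ L * Gamma (a - 1 - L) * rGamma (c - b - L) * rGamma (n - L) *
          rGamma (b + 1 + L - n)) +
      Gamma (a - n) * Gamma (1 - b) * rGamma (n + 1 - b) * rGamma (c - n) * rGamma a) := by
  induction n generalizing a c with
  | zero =>
    have h := hasSum_regTerm_zero_left a b 1 c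
    rw [← regTerm_comm_right] at h
    have h1 := hb1.gamma_mul_rGamma
    have h2 : Gamma a * rGamma a = 1 := NotNonposInt.gamma_mul_rGamma (by simpa using ha)
    refine h.of_eq (fun k => by simp) ?_
    · have h3 : rGamma 1 = 1 := by simp [rGamma]
      simp only [Finset.range_zero, Finset.sum_empty, Nat.cast_zero, sub_zero, zero_add, h3]
      linear_combination rGamma c * (Gamma a * rGamma a) * h1 + rGamma c * h2
  | succ n ih =>
    have ha' : NotNonposInt (a - 1 - n) := by convert ha using 1; push_cast; ring
    have hb' : NotNonposInt (b - n) := by convert hb.add_nat 1 using 1; push_cast; ring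
    have hs' : c - 1 - (a - 1) - b + 1 = c - a - b + 1 := by ring
    have h1 := ih (a := a - 1) (c := c - 1) (by rwa [hs']) ha' hb'
    have h2 := hasSum_gaussTerm (a := a - 1) (b := b - 1) (c := c - 1)
      (by convert hs using 2; ring)
    have h3 := (h1.mul_left (n.factorial : ℂ)).sub h2
    rw [← hasSum_nat_add_iff' 1] at h3
    simp only [factorial_mul_regTerm_natCast_succ] at h3
    have hn : (n.factorial : ℂ) ≠ 0 := Nat.cast_ne_zero.2 n.factorial_ne_zero
    have ha1 : a - 1 ≠ 0 := by
      have := ha.add_nat_ne_zero n; intro h; apply this; push_cast; linear_combination h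
    have hnb : (n : ℂ) + 1 - b ≠ 0 := by
      have := hb.ne_zero; intro h; apply this; push_cast; linear_combination -h
    have h4 := h3.mul_left ((a - 1) * (n + 1 - b) * n.factorial)⁻¹
    refine h4.of_eq (fun k => ?_) ?_
    · push_cast
      field_simp
    · have e1 : Gamma (b - n) = (b - n - 1) * Gamma (b - n - 1) := by
        rw [← Complex.Gamma_add_one _ (by intro h; apply hnb; linear_combination -h), sub_add_cancel]
      have e2 : rGamma (a - 1) = (a - 1) * rGamma a := by rw [rGamma_eq_mul, sub_add_cancel]
      have e3 : rGamma (n + 1 - b) = (n + 1 - b) * rGamma (n + 1 + 1 - b) := by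
        rw [rGamma_eq_mul]; congr 2; ring
      have e4 : Gamma (a - 1) * rGamma (a - 1) = 1 := NotNonposInt.gamma_mul_rGamma (by
        convert ha'.add_nat n using 1; ring)
      have e5 : Gamma (b - n) * rGamma (b - n) = 1 := hb'.gamma_mul_rGamma
      have hsum : (∑ L ∈ Finset.range (n + 1), (-1) ^ L * Gamma (a - 1 - L) * rGamma (c - b - L) *
            rGamma ((n + 1 : ℕ) - L) * rGamma (b + 1 + L - (n + 1 : ℕ))) =
          -(∑ L ∈ Finset.range n, (-1) ^ L * Gamma (a - 1 - 1 - L) * rGamma (c - 1 - b - L) *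
            rGamma (n - L) * rGamma (b + 1 + L - n)) +
          Gamma (a - 1) * rGamma (c - b) * rGamma (n + 1) * rGamma (b - n) := by
        rw [Finset.sum_range_succ', ← Finset.sum_neg_distrib]
        congr 1
        · refine Finset.sum_congr rfl fun L _ => ?_
          push_cast
          rw [show a - 1 - (L + 1) = a - 1 - 1 - (L : ℂ) by ring,
            show c - b - (L + 1) = c - 1 - b - (L : ℂ) by ring,
            show (n : ℂ) + 1 - (L + 1) = n - L by ring,
            show b + 1 + (L + 1) - (n + 1) = b + 1 + (L : ℂ) - n by ring]
          ring
        · push_cast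
          simp only [pow_zero, sub_zero, one_mul, add_zero]
          congr 2; ring
      rw [hsum, rGamma_nat_succ, hs']
      have h0 : (∑ i ∈ Finset.range 1, (↑n.factorial * regTerm (a - 1) b (↑n) (↑n + 1) (c - 1) i -
          gaussTerm (a - 1) (b - 1) (c - 1) i)) = 0 := by
        simp [regTerm, gaussTerm, rGamma_nat_succ, hn]
      rw [h0]
      simp only [show c - 1 - (a - 1) = c - a by ring, show c - 1 - (b - 1) = c - b by ring,
        show c - a - (b - 1) = c - a - b + 1 by ring, show c - 1 - (n : ℂ) = c - (n + 1) by ring,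
        show a - 1 - (n : ℂ) = a - (n + 1) by ring]
      push_cast
      rw [show b - ((n : ℂ) + 1) = b - n - 1 by ring, e3]
      set Sg := ∑ L ∈ Finset.range n, (-1) ^ L * Gamma (a - 1 - 1 - L) * rGamma (c - 1 - b - L) *
            rGamma (n - L) * rGamma (b + 1 + L - n)
      rw [inv_mul_eq_div, eq_div_iff (by simp [ha1, hnb, hn])]
      rw [e1] at e5 ⊢
      rw [e2] at e4 ⊢
      field_simp
      linear_combination (-Gamma (c - a - b + 1) * rGamma (c - a) * rGamma (c - b)) *
        ((b - n - 1) * Gamma (b - n - 1) * rGamma (b - n) * e4 + e5)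

lemma has3F2One_natCast_natCast_succ {n : ℕ} {a b c : ℂ} (hc : NotNonposInt c)
    (hs : NotNonposInt (c - a - b + 1)) (ha : NotNonposInt (a - n)) (hb : NotNonposInt (b - n))
    (hb1 : NotNonposInt (1 - b)) : Has3F2One a b n (n + 1) c
        (Gamma (b - n) *
            (∑ L ∈ Finset.range n,
              Gamma (-L + a - 1) * (-1) ^ L /
                (Gamma (-b + c - L) * Gamma (n - L) * Gamma (b + 1 + L - n))) *
            Gamma (n + 1) * Gamma c * Gamma (-b + c - a + 1) / (Gamma a * Gamma (c - a)) +
          Gamma (a - n) * Gamma (-b + 1) * Gamma (n + 1) * Gamma c /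
            (Gamma (n + 1 - b) * Gamma (c - n) * Gamma a)) := by
  have hn1 := notNonposInt_natCast_succ n
  have key := has3F2One_of_lower_right (a := a) (b := b) (c := n) (e := n + 1) (f := c)
    (fun c => Gamma (n + 1) * Gamma c * (Gamma (b - n) * Gamma (c - a - b + 1) * rGamma a *
      rGamma (c - a) * (∑ L ∈ Finset.range n, (-1) ^ L * Gamma (a - 1 - L) * rGamma (c - b - L) *
        rGamma (n - L) * rGamma (b + 1 + L - n)) +
      Gamma (a - n) * Gamma (1 - b) * rGamma (n + 1 - b) * rGamma (c - n) * rGamma a)) hn1 hc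
    (by convert hs using 1; ring) ?_ ?_
  · convert key using 1
    have hsum : (∑ L ∈ Finset.range n, Gamma (-L + a - 1) * (-1) ^ L /
        (Gamma (-b + c - L) * Gamma (n - L) * Gamma (b + 1 + L - n))) =
        ∑ L ∈ Finset.range n, (-1) ^ L * Gamma (a - 1 - L) * rGamma (c - b - L) *
          rGamma (n - L) * rGamma (b + 1 + L - n) :=
      Finset.sum_congr rfl fun L _ => by simp only [rGamma, div_eq_mul_inv]; ring_nf
    rw [hsum]
    generalize (Finset.sum (Finset.range n) _ : ℂ) = Sg
    simp only [rGamma, div_eq_mul_inv]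
    ring_nf
  · intro z h1 h2
    have h3 := Complex.differentiableAt_Gamma z h1
    have h4 := NotNonposInt.differentiableAt_gamma_add (z := z) (w := - a - b + 1)
      (by convert h2 using 1; ring)
    have h5 : ∀ z, z - a - b + 1 = z + (- a - b + 1) := fun z => by ring
    simp only [h5]
    fun_prop
  · intro z h1 h2
    exact hasSum_hyp3F2Term hn1 h1
      (hasSum_regTerm_natCast_natCast_succ n (by convert h2 using 2; ring) ha hb hb1)

/-! ### Upper parameter `1` with natural excess -/

lemma NotNonposInt.gamma_mul_rGamma_add_one {z : ℂ} (hz : NotNonposInt z) :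
    Gamma z * rGamma (z + 1) * z = 1 := by
  have h := hz.gamma_mul_rGamma
  rw [rGamma_eq_mul] at h
  linear_combination h

/-- The boundary value at infinity in the lowest case of the contiguous relation that follows. -/
lemma tendsto_regTerm_of_excess_eq_neg_one {a b c e f : ℂ} (hs : e + f - a - b - c = -1) :
    Tendsto (regTerm a b c e f) atTop (𝓝 (rGamma a * rGamma b * rGamma c)) := by
  rw [← tendsto_add_atTop_iff_nat 1]
  have h := (tendsto_regTerm_succ a b c e f).mul (tendsto_natCast_div_add_atTop (1 : ℂ))
  rw [mul_one] at h
  refine h.congr' ?_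
  filter_upwards [eventually_ne_atTop 0] with k hk
  have hk' : (k : ℂ) ≠ 0 := Nat.cast_ne_zero.2 hk
  have hk1 : (k : ℂ) + 1 ≠ 0 := Nat.cast_add_one_ne_zero k
  rw [hs, Complex.cpow_neg_one]
  field_simp

/-- A relation between the lower parameters c - 1 and c with f fixed. The boundary term has both
lower parameters reduced, hence excess n - 1. -/
lemma regTerm_one_excess_succ (n : ℕ) {a b c f : ℂ} (hf : f = a + b - c + n + 2) (N : ℕ) :
    ∑ k ∈ Finset.range N,
      (n * regTerm a b 1 (c - 1) f k - (c - 1 - a) * (c - 1 - b) * regTerm a b 1 c f k) =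
      rGamma (c - 1) * rGamma (f - 1) - regTerm a b 1 (c - 1) (f - 1) N := by
  induction N with
  | zero => simp [regTerm]
  | succ N ih =>
    rw [Finset.sum_range_succ, ih]
    have h0 : (N.factorial : ℂ) ≠ 0 := Nat.cast_ne_zero.2 N.factorial_ne_zero
    have hk1 : (N : ℂ) + 1 ≠ 0 := Nat.cast_add_one_ne_zero N
    have e1 : rGamma (c - 1 + N) = (c - 1 + N) * rGamma (c + N) := by
      rw [rGamma_eq_mul]; congr 2; ring
    have e2 : rGamma (f - 1 + N) = (f - 1 + N) * rGamma (f + N) := by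
      rw [rGamma_eq_mul]; congr 2; ring
    have e3 : c - 1 + (N + 1 : ℕ) = c + N := by push_cast; ring
    have e4 : f - 1 + (N + 1 : ℕ) = f + N := by push_cast; ring
    simp only [regTerm, rising_one_left, e3, e4, e1, e2, rising_succ a, rising_succ b,
      Nat.factorial_succ]
    push_cast
    field_simp
    rw [hf]
    ring

/-- For n = 0 the coefficient n removes the series with c - 1, which has excess 0, and the boundary
term of excess -1 has the limit 1/(Γ(a)Γ(b)); this is the source of the second product. For larger n
the boundary term vanishes at infinity, 1/(Γ(c - 1)Γ(f - 1)) supplies the summand L = 0, and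
replacing c by c - 1 shifts the others. -/
lemma hasSum_regTerm_one_excess (n : ℕ) {a b c f : ℂ} (hf : f = a + b - c + n + 2)
    (hac : NotNonposInt (a - c + 1)) (hb : NotNonposInt (c - b - (n + 1)))
    (ha : NotNonposInt (c - a - (n + 1))) :
    HasSum (regTerm a b 1 c f)
      (n.factorial * (rGamma (f - 1) * Gamma (a - c + 1) * rGamma (c - b) *
        (∑ L ∈ Finset.range (n + 1), (-1) ^ L * Gamma (c - b - 1 - L) * rGamma (c - 1 - L) *
          rGamma (n + 1 - L) * rGamma (a - c + 2 + L)) +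
        Gamma (c - b - (n + 1)) * Gamma (c - a - (n + 1)) * rGamma (c - a) * rGamma a *
          rGamma (c - b) * rGamma b)) := by
  induction n generalizing c with
  | zero =>
    have hsum : Summable (regTerm a b 1 c f) := summable_regTerm (by
      rw [show c + f - a - b - 1 = ((1 : ℕ) : ℂ) by rw [hf]; push_cast; ring]
      simp)
    have hxb : NotNonposInt (c - b - 1) := by convert hb.add_nat 0 using 1; push_cast; ring
    have hxa : NotNonposInt (c - a - 1) := by convert ha.add_nat 0 using 1; push_cast; ring
    have hb1 := hxb.ne_zero
    have ha1 := hxa.ne_zero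
    have g1 := hac.gamma_mul_rGamma_add_one
    have g2 := hxb.gamma_mul_rGamma_add_one
    have g3 := hxa.gamma_mul_rGamma_add_one
    rw [show a - c + 1 + 1 = a - c + 2 by ring] at g1
    rw [sub_add_cancel] at g2 g3
    have h := hasSum_of_partial_sums (hsum.mul_left (-((c - 1 - a) * (c - 1 - b))))
      (v := fun N => rGamma (c - 1) * rGamma (f - 1) - regTerm a b 1 (c - 1) (f - 1) N)
      (fun N => by rw [← regTerm_one_excess_succ 0 hf]; simp)
      (tendsto_const_nhds.sub (tendsto_regTerm_of_excess_eq_neg_one (by rw [hf]; push_cast; ring)))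
    have h2 := h.mul_left (-((c - a - 1) * (c - b - 1)))⁻¹
    refine h2.of_eq (fun k => ?_) ?_
    · field_simp
      ring
    · have e1 : rGamma 1 = 1 := by simp [rGamma]
      simp only [zero_add, Finset.sum_range_one, Nat.cast_zero, Nat.factorial_zero, Nat.cast_one,
        sub_zero, add_zero, pow_zero, one_mul, e1, mul_one]
      rw [inv_mul_eq_div, eq_div_iff (by simp [ha1, hb1])]
      linear_combination (rGamma (c - 1) * rGamma (f - 1)) *
        (Gamma (a - c + 1) * rGamma (a - c + 2) * (a - c + 1) * g2 + g1) -
        rGamma a * rGamma b * (Gamma (c - b - 1) * rGamma (c - b) * (c - b - 1) * g3 + g2)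
  | succ n ih =>
    have hsum : Summable (regTerm a b 1 c f) := summable_regTerm (by
      rw [show c + f - a - b - 1 = ((n + 1 + 1 : ℕ) : ℂ) by rw [hf]; push_cast; ring]
      simp; positivity)
    have hxb : NotNonposInt (c - b - 1) := by convert hb.add_nat (n + 1) using 1; push_cast; ring
    have hxa : NotNonposInt (c - a - 1) := by convert ha.add_nat (n + 1) using 1; push_cast; ring
    have hb1 := hxb.ne_zero
    have ha1 := hxa.ne_zero
    have g1 := hac.gamma_mul_rGamma_add_one
    have g2 := hxb.gamma_mul_rGamma_add_one
    have g3 := hxa.gamma_mul_rGamma_add_one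
    rw [show a - c + 1 + 1 = a - c + 2 by ring] at g1
    rw [sub_add_cancel] at g2 g3
    have hih := ih (c := c - 1) (by rw [hf]; push_cast; ring)
      (by convert hac.add_nat 1 using 1; push_cast; ring) (by convert hb using 1; push_cast; ring)
      (by convert ha using 1; push_cast; ring)
    have hl : Tendsto (regTerm a b 1 (c - 1) (f - 1)) atTop (𝓝 0) := tendsto_regTerm_zero (by
      rw [show c - 1 + (f - 1) - a - b - 1 = n by rw [hf]; push_cast; ring]
      simp; linarith [Nat.cast_nonneg (α := ℝ) n])
    have h := hasSum_of_partial_sums ((hih.summable.mul_left ((n + 1 : ℕ) : ℂ)).sub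
      (hsum.mul_left ((c - 1 - a) * (c - 1 - b))))
      (regTerm_one_excess_succ (n + 1) hf) (tendsto_const_nhds.sub hl)
    have h2 := ((hih.mul_left ((n + 1 : ℕ) : ℂ)).sub h).mul_left ((c - a - 1) * (c - b - 1))⁻¹
    refine h2.of_eq (fun k => ?_) ?_
    · field_simp
      ring
    · have hsg : (∑ L ∈ Finset.range (n + 1 + 1), (-1) ^ L * Gamma (c - b - 1 - L) *
            rGamma (c - 1 - L) * rGamma ((n + 1 : ℕ) + 1 - L) * rGamma (a - c + 2 + L)) =
          -(∑ L ∈ Finset.range (n + 1), (-1) ^ L * Gamma (c - 1 - b - 1 - L) *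
            rGamma (c - 1 - 1 - L) * rGamma (n + 1 - L) * rGamma (a - (c - 1) + 2 + L)) +
          Gamma (c - b - 1) * rGamma (c - 1) * ((n + 1).factorial : ℂ)⁻¹ * rGamma (a - c + 2) := by
        rw [Finset.sum_range_succ', ← Finset.sum_neg_distrib, ← rGamma_nat_succ]
        congr 1
        · refine Finset.sum_congr rfl fun L _ => ?_
          push_cast
          rw [show c - b - 1 - (L + 1) = c - 1 - b - 1 - (L : ℂ) by ring,
            show c - 1 - (L + 1) = c - 1 - 1 - (L : ℂ) by ring,
            show (n : ℂ) + 1 + 1 - (L + 1) = n + 1 - L by ring,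
            show a - c + 2 + (L + 1) = a - (c - 1) + 2 + (L : ℂ) by ring]
          ring
        · simp
      have hn : ((n + 1).factorial : ℂ) ≠ 0 := Nat.cast_ne_zero.2 (n + 1).factorial_ne_zero
      have hfac : ((n + 1 : ℕ) : ℂ) * n.factorial = (n + 1).factorial := by
        rw [Nat.factorial_succ]; push_cast; ring
      have e1 : rGamma (c - 1 - b) = (c - b - 1) * rGamma (c - b) := by
        rw [rGamma_eq_mul, show c - 1 - b + 1 = c - b by ring]; ring
      have e2 : rGamma (c - 1 - a) = (c - a - 1) * rGamma (c - a) := by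
        rw [rGamma_eq_mul, show c - 1 - a + 1 = c - a by ring]; ring
      have e3 : Gamma (a - (c - 1) + 1) = (a - c + 1) * Gamma (a - c + 1) := by
        rw [← Complex.Gamma_add_one _ hac.ne_zero]; congr 1; ring
      rw [hsg, inv_mul_eq_div, eq_div_iff (by simp [ha1, hb1]),
        ← mul_assoc ((n + 1 : ℕ) : ℂ) (n.factorial : ℂ) _, hfac, e1, e2, e3,
        show c - 1 - b - ((n : ℂ) + 1) = c - b - ((n + 1 : ℕ) + 1) by push_cast; ring,
        show c - 1 - a - ((n : ℂ) + 1) = c - a - ((n + 1 : ℕ) + 1) by push_cast; ring]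
      generalize (Finset.sum (Finset.range (n + 1)) _ : ℂ) = Sg
      field_simp
      linear_combination -(rGamma (c - 1) * rGamma (f - 1)) *
        (Gamma (a - c + 1) * rGamma (a - c + 2) * (a - c + 1) * g2 + g1)

/-! ### Upper parameter `n` with excess one -/

/-- Both series have excess one, so their terms decay like N^(-2) and the quadratic boundary factor
leaves a finite limit. -/
lemma regTerm_natCast_excess_one_succ (n : ℕ) {a b c f : ℂ} (hf : f = a + b - c + n + 2) (N : ℕ) :
    ∑ k ∈ Finset.range (N + 1),
      ((b + 1 - c) * (n + 1 + a - c) * regTerm (n + 1) a b c f k +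
        regTerm n (a - 1) b (c - 1) (f - 1) k) = (b + N) * (N + n + a) * regTerm (n + 1) a b c f N := by
  have e1 : ∀ N : ℕ, rGamma (c - 1 + N) = (c - 1 + N) * rGamma (c + N) := fun N => by
    rw [rGamma_eq_mul]; congr 2; ring
  have e2 : ∀ N : ℕ, rGamma (f - 1 + N) = (f - 1 + N) * rGamma (f + N) := fun N => by
    rw [rGamma_eq_mul]; congr 2; ring
  have e3 : ∀ N : ℕ, c + (N + 1 : ℕ) = c + N + 1 := fun N => by push_cast; ring
  have e4 : ∀ N : ℕ, f + (N + 1 : ℕ) = f + N + 1 := fun N => by push_cast; ring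
  induction N with
  | zero =>
    have e5 := e1 0
    have e6 := e2 0
    simp only [Nat.cast_zero, add_zero] at e5 e6
    simp [regTerm, e5, e6]
    rw [hf]
    ring
  | succ N ih =>
    rw [Finset.sum_range_succ, ih]
    have h0 : (N.factorial : ℂ) ≠ 0 := Nat.cast_ne_zero.2 N.factorial_ne_zero
    have hk1 : (N : ℂ) + 1 ≠ 0 := Nat.cast_add_one_ne_zero N
    have e5 : rising n (N + 1) = n * rising (n + 1) N := rising_succ_left _ _
    have e6 : rising (a - 1) (N + 1) = (a - 1) * rising a N := by
      rw [rising_succ_left, sub_add_cancel]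
    simp only [regTerm, e1, e2, e5, e6, rising_succ a, rising_succ b, rising_succ ((n : ℂ) + 1),
      Nat.factorial_succ, rGamma_eq_mul (c + N), rGamma_eq_mul (f + N), e3, e4]
    push_cast
    field_simp
    rw [hf]
    ring

/-- Each step lowers a, c and f by one, and the limit 1/(Γ(n + 1)Γ(a)Γ(b)) of the boundary term
becomes the new summand L = 0. For n = 0 the series is its first term. -/
lemma hasSum_regTerm_natCast_excess_one (n : ℕ) {a b c f : ℂ} (hf : f = a + b - c + n + 1)
    (hb : NotNonposInt (c - b - n)) (ha : NotNonposInt (c - a - n)) :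
    HasSum (regTerm n a b c f)
      (Gamma (c - a - n) * rGamma (c - b) * rGamma b *
        (∑ L ∈ Finset.range n, (-1) ^ L * Gamma (c - b - 1 - L) * rGamma (a - L) *
          rGamma (n - L) * rGamma (c + 1 - a - n + L)) +
        (-1) ^ n * Gamma (c - b - n) * Gamma (c - a - n) * rGamma (c - a) * rGamma (c - n) *
          rGamma (c - b) * rGamma (f - n)) := by
  induction n generalizing a c f with
  | zero =>
    refine (hasSum_regTerm_zero_left a b c f).of_eq (fun k => by simp) ?_
    simp only [Nat.cast_zero, sub_zero] at ha hb ⊢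
    simp only [Finset.range_zero, Finset.sum_empty, pow_zero]
    linear_combination rGamma c * rGamma f * (Gamma (c - a) * rGamma (c - a)) * hb.gamma_mul_rGamma +
      rGamma c * rGamma f * ha.gamma_mul_rGamma
  | succ n ih =>
    push_cast at hf ha hb ⊢
    have hxb : NotNonposInt (c - b - 1) := by convert hb.add_nat n using 1; ring
    have hb1 := hxb.ne_zero
    have ha1 := ha.ne_zero
    have g1 := ha.gamma_mul_rGamma_add_one
    have g2 := hxb.gamma_mul_rGamma_add_one
    rw [sub_add_cancel] at g2
    have hih := ih (a := a - 1) (c := c - 1) (f := f - 1) (by rw [hf]; ring)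
      (by convert hb using 1; ring) (by convert ha.add_nat 1 using 1; push_cast; ring)
    have hexc : c + f - (n + 1) - a - b = 1 := by rw [hf]; ring
    have hre : 0 < (c + f - (n + 1) - a - b).re := by rw [hexc]; simp
    have hsum : Summable (regTerm (n + 1) a b c f) := summable_regTerm hre
    have hlim : Tendsto (fun N : ℕ => (b + N) * (N + n + a) * regTerm (n + 1) a b c f N) atTop
        (𝓝 (rGamma (n + 1) * rGamma a * rGamma b)) := by
      rw [← tendsto_add_atTop_iff_nat 1]
      -- With N = k + 1, (b + N)(N + n + a) = k(k + 1) + (b + n + a + 1)(k + 1) + b(n + a); only the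
      -- first part contributes to the limit.
      have l1 := tendsto_mul_mul_regTerm hexc
      have l2 := (((tendsto_add_atTop_iff_nat 1).2 (tendsto_mul_regTerm hre))).const_mul (b + n + a + 1)
      have l3 := ((tendsto_add_atTop_iff_nat 1).2 hsum.tendsto_atTop_zero).const_mul (b * (n + a))
      have l4 := (l1.add l2).add l3
      rw [mul_zero, mul_zero, add_zero, add_zero] at l4
      refine l4.congr fun k => ?_
      push_cast
      ring
    have h := hasSum_of_partial_sums ((hsum.mul_left ((b + 1 - c) * (n + 1 + a - c))).add
      hih.summable) (v := fun N => ∑ k ∈ Finset.range N,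
      ((b + 1 - c) * (n + 1 + a - c) * regTerm (n + 1) a b c f k +
        regTerm n (a - 1) b (c - 1) (f - 1) k)) (fun N => rfl)
      ((tendsto_add_atTop_iff_nat 1).1 (by
        simpa only [regTerm_natCast_excess_one_succ n (show f = a + b - c + n + 2 by rw [hf]; ring)] using hlim))
    have h2 := (h.sub hih).mul_left ((c - b - 1) * (c - a - (n + 1)))⁻¹
    refine h2.of_eq (fun k => ?_) ?_
    · field_simp
      ring
    · have hsg : (∑ L ∈ Finset.range (n + 1), (-1) ^ L * Gamma (c - b - 1 - L) * rGamma (a - L) *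
            rGamma (n + 1 - L) * rGamma (c + 1 - a - (n + 1) + L)) =
          -(∑ L ∈ Finset.range n, (-1) ^ L * Gamma (c - 1 - b - 1 - L) * rGamma (a - 1 - L) *
            rGamma (n - L) * rGamma (c - 1 + 1 - (a - 1) - n + L)) +
          Gamma (c - b - 1) * rGamma a * rGamma (n + 1) * rGamma (c - a - (n + 1) + 1) := by
        rw [Finset.sum_range_succ', ← Finset.sum_neg_distrib]
        congr 1
        · refine Finset.sum_congr rfl fun L _ => ?_
          push_cast
          rw [show c - b - 1 - (L + 1) = c - 1 - b - 1 - (L : ℂ) by ring,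
            show a - (L + 1) = a - 1 - (L : ℂ) by ring,
            show (n : ℂ) + 1 - (L + 1) = n - L by ring,
            show c + 1 - a - (n + 1) + (L + 1) = c - 1 + 1 - (a - 1) - n + (L : ℂ) by ring]
          ring
        · push_cast
          simp only [pow_zero, sub_zero, one_mul, add_zero]
          congr 2; ring
      rw [hsg, inv_mul_eq_div, eq_div_iff (by simp [ha1, hb1])]
      have e1 : rGamma (c - 1 - b) = (c - b - 1) * rGamma (c - b) := by
        rw [rGamma_eq_mul, show c - 1 - b + 1 = c - b by ring]; ring
      have e2 : Gamma (c - 1 - (a - 1) - n) = (c - a - (n + 1)) * Gamma (c - a - (n + 1)) := by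
        rw [← Complex.Gamma_add_one _ ha1]; congr 1; ring
      rw [e1, e2, show c - 1 - (a - 1) = c - a by ring, show c - 1 - (n : ℂ) = c - (n + 1) by ring,
        show f - 1 - (n : ℂ) = f - (n + 1) by ring, show c - 1 - b - (n : ℂ) = c - b - (n + 1) by ring,
        pow_succ]
      linear_combination (rGamma a * rGamma b * rGamma (n + 1)) *
        (Gamma (c - b - 1) * rGamma (c - b) * (c - b - 1) * g1 + g2)

lemma hasSum_hyp3F2Term_one_excess {n : ℕ} {a b c : ℂ} (hn : 0 < n) (hc : NotNonposInt c)
    (hf : NotNonposInt (-c + b + a + n + 1)) (hac : NotNonposInt (-c + a + 1))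
    (hb : NotNonposInt (-b + c - n)) (ha : NotNonposInt (c - a - n)) :
    HasSum (hyp3F2Term 1 a b c (-c + b + a + n + 1))
        ((-c + b + a + n) * Gamma (-c + a + 1) *
            (∑ L ∈ Finset.range n,
              Gamma (-L + c - b - 1) * (-1) ^ L /
                (Gamma (c - 1 - L) * Gamma (n - L) * Gamma (-c + a + 2 + L))) *
            Gamma n * Gamma c / Gamma (c - b) +
          Gamma (-c + b + a + n + 1) * Gamma (-b + c - n) * Gamma (c - a - n) * Gamma n *
            Gamma c / (Gamma (c - a) * Gamma a * Gamma (c - b) * Gamma b)) := by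
  obtain ⟨n, rfl⟩ := Nat.exists_eq_succ_of_ne_zero hn.ne'
  rw [Nat.succ_eq_add_one] at *
  have h := hasSum_regTerm_one_excess n (a := a) (b := b) (c := c)
    (f := -c + b + a + (n + 1 : ℕ) + 1) (by push_cast; ring) (by convert hac using 1; ring)
    (by convert hb using 1; push_cast; ring) (by convert ha using 1; push_cast; ring)
  rw [regTerm_comm_right] at h
  refine (hasSum_hyp3F2Term hc hf h).of_eq (fun k => rfl) ?_
  have hsum : (∑ L ∈ Finset.range (n + 1), Gamma (-L + c - b - 1) * (-1) ^ L /
      (Gamma (c - 1 - L) * Gamma ((n + 1 : ℕ) - L) * Gamma (-c + a + 2 + L))) =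
      ∑ L ∈ Finset.range (n + 1), (-1) ^ L * Gamma (c - b - 1 - L) * rGamma (c - 1 - L) *
          rGamma (n + 1 - L) * rGamma (a - c + 2 + L) :=
    Finset.sum_congr rfl fun L _ => by
      push_cast; simp only [rGamma, div_eq_mul_inv]; ring_nf
  rw [hsum]
  generalize (Finset.sum (Finset.range (n + 1)) _ : ℂ) = Sg
  -- The linear factor of the closed form is Γ(f)/Γ(f - 1).
  have e1 : Gamma (-c + b + a + (n + 1 : ℕ) + 1) * rGamma (-c + b + a + (n + 1 : ℕ) + 1 - 1) =
      -c + b + a + (n + 1 : ℕ) := by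
    rw [rGamma_eq_mul, sub_add_cancel]
    linear_combination (-c + b + a + (n + 1 : ℕ)) * hf.gamma_mul_rGamma
  have e2 : Gamma ((n + 1 : ℕ) : ℂ) = n.factorial := by
    rw [← Complex.Gamma_nat_eq_factorial]; push_cast; rfl
  rw [e2, show a - c + 1 = -c + a + 1 by ring,
    show c - b - ((n : ℂ) + 1) = -b + c - (n + 1 : ℕ) by push_cast; ring,
    show c - a - ((n : ℂ) + 1) = c - a - (n + 1 : ℕ) by push_cast; ring]
  simp only [rGamma] at e1 ⊢
  linear_combination
    -(Gamma (-c + a + 1) * Sg * n.factorial * Gamma c * (Gamma (c - b))⁻¹) * e1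

lemma hasSum_hyp3F2Term_natCast_excess_one {n : ℕ} {a b c : ℂ} (hc : NotNonposInt c)
    (hf : NotNonposInt (-c + b + a + n + 1))
    (hb : NotNonposInt (-b + c - n)) (ha : NotNonposInt (c - a - n)) :
    HasSum (hyp3F2Term n a b c (-c + b + a + n + 1))
        (Gamma (-c + b + a + n + 1) * Gamma (c - a - n) *
            (∑ L ∈ Finset.range n,
              Gamma (-L + c - b - 1) * (-1) ^ L /
                (Gamma (a - L) * Gamma (n - L) * Gamma (c + 1 - a - n + L))) *
            Gamma c / (Gamma (c - b) * Gamma b) +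
          Gamma (-c + b + a + n + 1) * Gamma (-b + c - n) * (-1) ^ n * Gamma (c - a - n) *
            Gamma c /
            (Gamma (c - a) * Gamma (c - n) * Gamma (c - b) * Gamma (-c + b + 1 + a))) := by
  have h := hasSum_regTerm_natCast_excess_one n (a := a) (b := b) (c := c)
    (f := -c + b + a + n + 1) (by ring) (by convert hb using 1; ring) ha
  refine (hasSum_hyp3F2Term hc hf h).of_eq (fun k => rfl) ?_
  have hsum : (∑ L ∈ Finset.range n, Gamma (-L + c - b - 1) * (-1) ^ L /
      (Gamma (a - L) * Gamma (n - L) * Gamma (c + 1 - a - n + L))) =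
      ∑ L ∈ Finset.range n, (-1) ^ L * Gamma (c - b - 1 - L) * rGamma (a - L) *
          rGamma (n - L) * rGamma (c + 1 - a - n + L) :=
    Finset.sum_congr rfl fun L _ => by
      simp only [rGamma, div_eq_mul_inv]; ring_nf
  rw [hsum]
  generalize (Finset.sum (Finset.range n) _ : ℂ) = Sg
  rw [show c - b - (n : ℂ) = -b + c - n by ring,
    show -c + b + a + (n : ℂ) + 1 - n = -c + b + 1 + a by ring]
  simp only [rGamma]
  ring

lemma differentiable_rising (k : ℕ) : Differentiable ℂ fun x => rising x k :=
  (ascPochhammer ℂ k).differentiable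

attribute [fun_prop] differentiable_rising

lemma gamma_mul_rGamma_sub_one {z : ℂ} (hz : NotNonposInt z) : Gamma z * rGamma (z - 1) = z - 1 := by
  rw [rGamma_eq_mul, sub_add_cancel]
  linear_combination (z - 1) * hz.gamma_mul_rGamma

lemma neg_one_pow_mul_self (n : ℕ) : (-1 : ℂ) ^ n * (-1) ^ n = 1 := by
  rw [← mul_pow]; simp

/-! ### Upper parameter `b` over lower parameters `b + 1`, `b - n + 1` -/

/-- After (b)_k / Γ(b + 1 + k) = 1/(Γ(b)(b + k)), this is the identity (b - c)(b - n + k) = n(c + k)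
+ (b - n - c)(b + k). -/
lemma regTerm_self_add_one (n : ℕ) {a b c : ℂ} {k : ℕ} (hb : b + k ≠ 0) :
    (b - c) * regTerm a b c (b + 1) (b - n) k =
      n * c * regTerm a b (c + 1) (b + 1) (b - n + 1) k +
        (b - n - c) * rGamma b * gaussTerm a c (b - n + 1) k := by
  have h1 := rising_mul_rGamma_succ hb
  have h2 : c * rising (c + 1) k = rising c k * (c + k) := by
    rw [← rising_succ_left, rising_succ]
  have h3 : rGamma (b - n + k) = (b - n + k) * rGamma (b - n + 1 + k) := by
    rw [rGamma_eq_mul]; congr 2; ring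
  have h4 : rising b k * rGamma (b + 1 + k) * (b + k) = rGamma b := by
    rw [h1]; field_simp
  simp only [regTerm, gaussTerm, h3]
  linear_combination (-n * rising a k * rising b k * rGamma (b + 1 + k) * rGamma (b - n + 1 + k) *
    (k.factorial : ℂ)⁻¹) * h2 + (rising a k * rising c k * (k.factorial : ℂ)⁻¹ *
      rGamma (b - n + 1 + k) * (b - n - c)) * h4

/-- In the induction c rises by one. The Gauss series supplies the top summand, and c (c + 1)_{n-L}
= (c)_{n+1-L} absorbs the coefficient of the others. With rising factorials in place of gamma
quotients, the only poles in a are those of Γ at the excess. -/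
lemma hasSum_regTerm_self_add_one (n : ℕ) {a b c : ℂ} (hb : NotNonposInt (b - n))
    (hbc : NotNonposInt (b - c - n)) (hs : 0 < (b - c - n + 1 - a).re) :
    HasSum (regTerm a b c (b + 1) (b - n))
      (rGamma b * Gamma (b - c - n + 1 - a) * n.factorial * rGamma (b - a + 1) *
        rGamma (1 + b - c) * ∑ L ∈ Finset.range (n + 1), (-1) ^ L * rising (a - b) L *
          rising (b - c - n) L * rising c (n - L) * (L.factorial : ℂ)⁻¹) := by
  induction n generalizing c with
  | zero =>
    simp only [Nat.cast_zero, sub_zero] at hb hbc hs ⊢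
    have hne := hbc.ne_zero
    have h := (hasSum_gaussTerm (a := a) (b := c) (c := b + 1)
      (by convert hs using 2; ring)).mul_left (rGamma b)
    refine h.of_eq (fun k => ?_) ?_
    · have := regTerm_self_add_one 0 (a := a) (c := c) (hb.add_nat_ne_zero k)
      simp only [Nat.cast_zero, sub_zero, zero_mul, zero_add] at this
      apply mul_left_cancel₀ hne
      rw [this]; ring
    · simp [show b + 1 - a = b - a + 1 by ring,
        show b + 1 - c = 1 + b - c by ring]
      ring_nf
  | succ n ih =>
    have hb' : NotNonposInt (b - n) := by convert hb.add_nat 1 using 1; push_cast; ring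
    have hb0 : NotNonposInt b := by convert hb'.add_nat n using 1; ring
    have hne : b - c ≠ 0 := by
      have := hbc.add_nat_ne_zero (n + 1); rwa [sub_add_cancel] at this
    have e0 : b - (c + 1) - n + 1 - a = b - c - (n + 1 : ℕ) + 1 - a := by push_cast; ring
    have hih := ih (c := c + 1) hb' (by convert hbc using 1; push_cast; ring) (by rwa [e0])
    have hg := hasSum_gaussTerm (a := a) (b := c) (c := b - n)
      (by convert hs using 2; push_cast; ring)
    have h := ((hih.mul_left ((n + 1 : ℕ) * c)).add
      (hg.mul_left ((b - (n + 1 : ℕ) - c) * rGamma b))).mul_left (b - c)⁻¹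
    refine h.of_eq (fun k => ?_) ?_
    · have := regTerm_self_add_one (n + 1) (a := a) (c := c) (hb0.add_nat_ne_zero k)
      rw [eq_inv_mul_iff_mul_eq₀ hne, this, show b - (n + 1 : ℕ) + 1 = b - n by push_cast; ring]
    · rw [eq_inv_mul_iff_mul_eq₀ hne, Finset.sum_range_succ, Nat.sub_self, rising_zero]
      have hsum : ∑ L ∈ Finset.range (n + 1), (-1) ^ L * rising (a - b) L *
          rising (b - c - (n + 1 : ℕ)) L * rising c (n + 1 - L) * (L.factorial : ℂ)⁻¹ =
          c * ∑ L ∈ Finset.range (n + 1), (-1) ^ L * rising (a - b) L *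
          rising (b - (c + 1) - n) L * rising (c + 1) (n - L) * (L.factorial : ℂ)⁻¹ := by
        rw [Finset.mul_sum]
        refine Finset.sum_congr rfl fun L hL => ?_
        rw [Nat.succ_sub (Nat.lt_succ_iff.1 (Finset.mem_range.1 hL)), rising_succ_left c,
          show b - c - (n + 1 : ℕ) = b - (c + 1) - n by push_cast; ring]
        ring
      rw [hsum, e0]
      generalize (Finset.sum (Finset.range (n + 1)) _ : ℂ) = Sg
      have hn : ((n + 1).factorial : ℂ) ≠ 0 := Nat.cast_ne_zero.2 (n + 1).factorial_ne_zero
      have hfac : ((n + 1).factorial : ℂ) = ((n + 1 : ℕ) : ℂ) * n.factorial := by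
        rw [Nat.factorial_succ]; push_cast; ring
      have hcanc := mul_inv_cancel₀ hn
      have f1 : rGamma (b - n - a) = (-1) ^ (n + 1) * rising (a - b) (n + 1) * rGamma (b - a + 1) := by
        rw [rGamma_eq_rising_mul _ (n + 1), rising_reflect (b - n - a) (n + 1),
          show b - n - a + (n + 1 : ℕ) = b - a + 1 by push_cast; ring,
          show 1 - (b - n - a) - (n + 1 : ℕ) = a - b by push_cast; ring]
      have f2 : (b - (n + 1 : ℕ) - c) * rGamma (b - n - c) =
          rising (b - c - (n + 1 : ℕ)) (n + 1) * rGamma (b - c) := by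
        rw [show b - n - c = b - (n + 1 : ℕ) - c + 1 by push_cast; ring, ← rGamma_eq_mul,
          rGamma_eq_rising_mul _ (n + 1)]
        congr 2 <;> ring
      have f3 : rGamma (b - c) = (b - c) * rGamma (1 + b - c) := by
        rw [rGamma_eq_mul]; congr 2; ring
      have f4 : rGamma (1 + b - (c + 1)) = (b - c) * rGamma (1 + b - c) := by
        rw [← f3]; congr 1; ring
      rw [f3] at f2
      rw [f4, f1, show b - n - a - c = b - c - (n + 1 : ℕ) + 1 - a by push_cast; ring]
      set Gs := Gamma (b - c - (n + 1 : ℕ) + 1 - a)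
      linear_combination (b - c) * rGamma b * Gs * rGamma (b - a + 1) * rGamma (1 + b - c) * c * Sg * hfac
        + (b - c) * rGamma b * Gs * rGamma (b - a + 1) * rGamma (1 + b - c) * (-1) ^ (n + 1) *
          rising (a - b) (n + 1) * rising (b - c - (n + 1 : ℕ)) (n + 1) * hcanc
        - rGamma b * Gs * (-1) ^ (n + 1) * rising (a - b) (n + 1) * rGamma (b - a + 1) * f2

lemma has3F2One_self_add_one {n : ℕ} {a b c : ℂ} (hn : 0 < n) (hb : NotNonposInt (-n + b + 1))
    (hs : NotNonposInt (b - c - n + 2 - a)) (hab : NotNonposInt (-b + a))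
    (hbc : NotNonposInt (-c - n + b + 1)) (hc : NotNonposInt (-c + 1)) :
      Has3F2One a b c (b + 1) (-n + b + 1)
        (-(-1) ^ n * b *
          (∑ L ∈ Finset.range n,
            Gamma (-b + a + L) * Gamma (-c - n + b + 1 + L) /
              (Gamma (L + 1) * Gamma (-c - n + 2 + L))) *
          Gamma (b - c - n + 2 - a) * Gamma (-n + b + 1) * Gamma n * Gamma (-c + 1) /
          (Gamma (a - b) * Gamma (b - a + 1) * Gamma (b - c - n + 1) * Gamma (1 + b - c))) := by
  obtain ⟨n, rfl⟩ := Nat.exists_eq_succ_of_ne_zero hn.ne'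
  rw [Nat.succ_eq_add_one] at *
  rw [show -((n + 1 : ℕ) : ℂ) + b + 1 = b - n by push_cast; ring] at *
  rw [show b - c - (n + 1 : ℕ) + 2 - a = b - c - n + 1 - a by push_cast; ring] at *
  rw [show -c - (n + 1 : ℕ) + b + 1 = b - c - n by push_cast; ring] at *
  rw [show -b + a = a - b by ring, show -c + 1 = 1 - c by ring] at *
  have hb0 : NotNonposInt b := by convert hb.add_nat n using 1; ring
  have hb1 : NotNonposInt (b + 1) := by simpa using hb0.add_nat 1
  have key := has3F2One_of_upper (a := a) (b := b) (c := c) (e := b + 1) (f := b - n)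
    (fun a => Gamma (b + 1) * Gamma (b - n) * (rGamma b * Gamma (b - c - n + 1 - a) *
      n.factorial * rGamma (b - a + 1) *
        rGamma (1 + b - c) * ∑ L ∈ Finset.range (n + 1), (-1) ^ L * rising (a - b) L *
          rising (b - c - n) L * rising c (n - L) * (L.factorial : ℂ)⁻¹)) hb1 hb
    (by convert hs using 1; ring) ?_ ?_
  · convert key using 1
    have e1 : Gamma (b + 1) * rGamma b = b := by
      simpa using gamma_mul_rGamma_sub_one hb1
    have e2 : Gamma ((n + 1 : ℕ) : ℂ) = n.factorial := by
      rw [← Complex.Gamma_nat_eq_factorial]; push_cast; rfl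
    have hsum : ∑ L ∈ Finset.range (n + 1), (-1) ^ L * rising (a - b) L *
          rising (b - c - n) L * rising c (n - L) * (L.factorial : ℂ)⁻¹ =
        (-1) ^ n * (∑ L ∈ Finset.range (n + 1), Gamma (a - b + L) * Gamma (b - c - n + L) /
          (Gamma (L + 1) * Gamma (-c - (n + 1 : ℕ) + 2 + L))) * Gamma (1 - c) * rGamma (a - b) *
            rGamma (b - c - n) := by
      rw [Finset.mul_sum, Finset.sum_mul, Finset.sum_mul, Finset.sum_mul]
      refine Finset.sum_congr rfl fun L hL => ?_
      obtain ⟨j, rfl⟩ : ∃ j, n = L + j :=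
        ⟨n - L, by have := Finset.mem_range.1 hL; omega⟩
      have f1 : (Gamma (-c - (L + j + 1 : ℕ) + 2 + L))⁻¹ = (-1) ^ j * rising c j * rGamma (1 - c) := by
        rw [rising_reflect c j, ← mul_assoc, neg_one_pow_mul_self, one_mul]
        change rGamma _ = _
        rw [rGamma_eq_rising_mul _ j]
        congr 2 <;> (push_cast; ring)
      rw [Nat.add_sub_cancel_left, hab.gamma_add_nat, hbc.gamma_add_nat,
        Complex.Gamma_nat_eq_factorial, div_eq_mul_inv, mul_inv, f1, pow_add]
      have g1 := hab.gamma_mul_rGamma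
      have g2 := hbc.gamma_mul_rGamma
      have g3 := hc.gamma_mul_rGamma
      have g4 := neg_one_pow_mul_self j
      calc _ = (-1) ^ L * rising (a - b) L * rising (b - c - (L + j : ℕ)) L * rising c j *
            (L.factorial : ℂ)⁻¹ * (Gamma (a - b) * rGamma (a - b)) *
            (Gamma (b - c - (L + j : ℕ)) * rGamma (b - c - (L + j : ℕ))) *
            (Gamma (1 - c) * rGamma (1 - c)) * ((-1) ^ j * (-1) ^ j) := by
              rw [g1, g2, g3, g4]; ring
        _ = _ := by ring
    rw [hsum, e2]
    generalize (Finset.sum (Finset.range (n + 1)) _ : ℂ) = Sg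
    rw [show b - c - (n + 1 : ℕ) + 1 = b - c - n by push_cast; ring, pow_succ]
    simp only [rGamma] at e1 ⊢
    rw [div_eq_mul_inv, mul_inv, mul_inv, mul_inv]
    linear_combination -(Gamma (b - n) * Gamma (b - c - n + 1 - a) * n.factorial *
      (Gamma (b - a + 1))⁻¹ * (Gamma (1 + b - c))⁻¹ * (-1) ^ n * Sg * Gamma (1 - c) *
      (Gamma (a - b))⁻¹ * (Gamma (b - c - n))⁻¹) * e1
  · intro z h2
    have h3 : NotNonposInt (b - c - n + 1 - z) := by convert h2 using 1; ring
    have h4 : DifferentiableAt ℂ (fun x => Gamma (b - c - n + 1 - x)) z :=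
      (Complex.differentiableAt_Gamma _ h3).comp z (by fun_prop)
    fun_prop
  · intro z h2
    exact hasSum_hyp3F2Term hb1 hb
      (hasSum_regTerm_self_add_one n hb hbc (by convert h2 using 2; ring))

/-! ### Upper parameters `b`, `1` over the lower parameter `b - n + 1` -/

/-- Up to a constant, the term is (a)_k / Γ(c + k) times the polynomial (β + k)_n in k; this form
telescopes. -/
lemma rising_mul_eq_regTerm (n : ℕ) {a c β : ℂ} (hβ : NotNonposInt β) (k : ℕ) :
    rising a k * rGamma (c + k) * rising (β + k) n =
      Gamma β * rising β n * regTerm a (β + n) 1 c β k := by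
  have h1 := rising_mul_comm β n k
  have h2 := hβ.gamma_mul_rGamma
  have h3 := hβ.rising_ne_zero k
  have h4 : (k.factorial : ℂ) ≠ 0 := Nat.cast_ne_zero.2 k.factorial_ne_zero
  rw [regTerm, hβ.rGamma_add_nat, rising_one_left]
  calc _ = rising a k * rGamma (c + k) * (rising β k * rising (β + k) n) * (Gamma β * rGamma β) /
        rising β k := by rw [h2]; field_simp
    _ = _ := by rw [← h1]; field_simp

lemma sum_rising_zero (a c : ℂ) (M : ℕ) :
    ∑ k ∈ Finset.range (M + 1), (a - c + 1) * (rising a k * rGamma (c + k)) =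
      (a + M) * (rising a M * rGamma (c + M)) - rGamma (c - 1) := by
  induction M with
  | zero =>
    have : rGamma (c - 1) = (c - 1) * rGamma c := by rw [rGamma_eq_mul, sub_add_cancel]
    simp [this]; ring
  | succ M ih =>
    rw [Finset.sum_range_succ, ih, rising_succ, rGamma_eq_mul (c + M)]
    push_cast
    rw [← add_assoc]
    ring

/-- Multiplying the summand of degree n + 1 by a + M gives a boundary term that links the sums of
degrees n + 1 and n. -/
lemma sum_rising_succ (n : ℕ) (a c β : ℂ) (M : ℕ) :
    ∑ k ∈ Finset.range (M + 1),
      ((a - c + n + 2) * (rising a k * rGamma (c + k) * rising (β + k) (n + 1)) +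
        (n + 1) * (c - β - n - 1) * (rising a k * rGamma (c + k) * rising (β + k) n)) =
      (a + M) * (rising a M * rGamma (c + M) * rising (β + M) (n + 1)) -
        rGamma (c - 1) * rising (β - 1) (n + 1) := by
  induction M with
  | zero =>
    have h1 : rGamma (c - 1) = (c - 1) * rGamma c := by rw [rGamma_eq_mul, sub_add_cancel]
    have h2 : rising (β - 1) (n + 1) = (β - 1) * rising β n := by
      rw [rising_succ_left, sub_add_cancel]
    simp [h1, h2, rising_succ]; ring
  | succ M ih =>
    rw [Finset.sum_range_succ, ih, rising_succ a, rGamma_eq_mul (c + M), rising_succ_left (β + M)]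
    push_cast
    rw [← add_assoc, ← add_assoc, ← add_assoc, rising_succ (β + M + 1) n]
    ring

lemma tendsto_add_mul_rising (n : ℕ) {a c β : ℂ} (hβ : NotNonposInt β)
    (hs : 0 < (c - a - n - 1).re) :
    Tendsto (fun M : ℕ => (a + M) * (rising a M * rGamma (c + M) * rising (β + M) n)) atTop
      (𝓝 0) := by
  have hre : 0 < (c + β - a - (β + n) - 1).re := by convert hs using 2; ring
  have h := ((tendsto_mul_regTerm hre).add
    ((summable_regTerm hre).tendsto_atTop_zero.const_mul a)).const_mul (Gamma β * rising β n)
  rw [mul_zero, add_zero, mul_zero] at h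
  refine h.congr fun M => ?_
  rw [rising_mul_eq_regTerm n hβ]
  ring

/-- In the recurrence the constant (β - 1)_{n+1}/Γ(c - 1) gives the last summand, and the earlier
ones all acquire the factor (β - c + 1 + n)/(a - c + n + 2). The denominator is minus the excess,
hence nonzero. -/
lemma hasSum_rising_mul (n : ℕ) {a c β : ℂ} (hβ : NotNonposInt β) (hs : 0 < (c - a - n - 1).re) :
    HasSum (fun k : ℕ => rising a k * rGamma (c + k) * rising (β + k) n)
      (-rGamma (c - 1) * n.factorial * ∑ L ∈ Finset.range (n + 1), rising (β - 1) L *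
        (L.factorial : ℂ)⁻¹ * rising (β - c + 1 + L) (n - L) *
          (rising (a + 1 - c + L) (n + 1 - L))⁻¹) := by
  have hsum : Summable (fun k : ℕ => rising a k * rGamma (c + k) * rising (β + k) n) := by
    simp only [rising_mul_eq_regTerm n hβ]
    exact (summable_regTerm (by convert hs using 2; ring)).mul_left _
  have hlim := tendsto_add_mul_rising n hβ hs
  induction n with
  | zero =>
    have hne : a - c + 1 ≠ 0 := by
      rintro h
      rw [show c - a - (0 : ℕ) - 1 = -(a - c + 1) by push_cast; ring, h] at hs
      simp at hs
    have h := hasSum_of_partial_sums (hsum.mul_left (a - c + 1)) (fun N => rfl)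
      ((tendsto_add_atTop_iff_nat 1).1 (by
        simpa [sum_rising_zero] using hlim.sub_const (rGamma (c - 1))))
    refine (h.mul_left (a - c + 1)⁻¹).of_eq (fun k => ?_) ?_
    · field_simp
    · simp [show a + 1 - c = a - c + 1 by ring]
      ring
  | succ n ih =>
    have hs' : 0 < (c - a - n - 1).re := by
      push_cast at hs
      simp only [Complex.sub_re, Complex.add_re, Complex.one_re, Complex.natCast_re] at hs ⊢
      linarith
    have hne : a - c + n + 2 ≠ 0 := by
      rintro h
      rw [show c - a - (n + 1 : ℕ) - 1 = -(a - c + n + 2) by push_cast; ring, h] at hs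
      simp at hs
    have hsum' : Summable (fun k : ℕ => rising a k * rGamma (c + k) * rising (β + k) n) := by
      simp only [rising_mul_eq_regTerm n hβ]
      exact (summable_regTerm (by convert hs' using 2; ring)).mul_left _
    have hih := ih hs' hsum' (tendsto_add_mul_rising n hβ hs')
    have h := hasSum_of_partial_sums ((hsum.mul_left (a - c + n + 2)).add
      (hsum'.mul_left ((n + 1) * (c - β - n - 1)))) (fun N => rfl)
      ((tendsto_add_atTop_iff_nat 1).1 (by
        simpa only [sum_rising_succ] using
          hlim.sub_const (rGamma (c - 1) * rising (β - 1) (n + 1))))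
    refine ((h.sub (hih.mul_left ((n + 1) * (c - β - n - 1)))).mul_left
      (a - c + n + 2)⁻¹).of_eq (fun k => ?_) ?_
    · rw [add_sub_cancel_right, inv_mul_cancel_left₀ hne]
    · rw [eq_inv_mul_iff_mul_eq₀ hne, Finset.sum_range_succ, Nat.sub_self, rising_zero,
        Nat.add_sub_cancel_left, rising_one]
      have hS : ∑ L ∈ Finset.range (n + 1), rising (β - 1) L * (L.factorial : ℂ)⁻¹ *
          rising (β - c + 1 + L) (n + 1 - L) * (rising (a + 1 - c + L) (n + 1 + 1 - L))⁻¹ =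
          (β - c + 1 + n) * (a - c + n + 2)⁻¹ * ∑ L ∈ Finset.range (n + 1), rising (β - 1) L *
            (L.factorial : ℂ)⁻¹ * rising (β - c + 1 + L) (n - L) *
              (rising (a + 1 - c + L) (n + 1 - L))⁻¹ := by
        rw [Finset.mul_sum]
        refine Finset.sum_congr rfl fun L hL => ?_
        have hL' := Nat.lt_succ_iff.1 (Finset.mem_range.1 hL)
        rw [Nat.succ_sub hL', Nat.succ_sub (hL'.trans n.le_succ), rising_succ, rising_succ,
          Nat.succ_sub hL', Nat.cast_succ, Nat.cast_sub hL',
          show β - c + 1 + L + (n - L) = β - c + 1 + n by ring,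
          show a + 1 - c + L + (n - L + 1) = a - c + n + 2 by ring, mul_inv]
        ring
      have hn : ((n + 1).factorial : ℂ) ≠ 0 := Nat.cast_ne_zero.2 (n + 1).factorial_ne_zero
      have hfac : ((n + 1).factorial : ℂ) = (n + 1) * n.factorial := by
        rw [Nat.factorial_succ]; push_cast; ring
      rw [hS, show a + 1 - c + (n + 1 : ℕ) = a - c + n + 2 by push_cast; ring]
      generalize (Finset.sum (Finset.range (n + 1)) _ : ℂ) = Sg
      field_simp
      rw [hfac]
      ring

lemma hasSum_regTerm_one_sub (n : ℕ) {a b c : ℂ} (hb : NotNonposInt (b - n))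
    (hs : 0 < (c - a - n - 1).re) :
    HasSum (regTerm a b 1 c (b - n))
      (-rGamma (c - 1) * rGamma b * n.factorial *
        ∑ L ∈ Finset.range (n + 1), rising (b - n - 1) L *
        (L.factorial : ℂ)⁻¹ * rising (b - n - c + 1 + L) (n - L) *
          (rising (a + 1 - c + L) (n + 1 - L))⁻¹) := by
  have h := (hasSum_rising_mul n hb hs).mul_left (Gamma (b - n) * rising (b - n) n)⁻¹
  have h1 := hb.gamma_ne_zero
  have h2 := hb.rising_ne_zero n
  refine h.of_eq (fun k => ?_) ?_
  · rw [rising_mul_eq_regTerm n hb, sub_add_cancel]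
    field_simp
  · have h3 : rGamma b = (Gamma (b - n) * rising (b - n) n)⁻¹ := by
      rw [mul_comm, ← hb.gamma_add_nat, sub_add_cancel, rGamma]
    rw [h3]
    ring

lemma has3F2One_one_sub {n : ℕ} {a b c : ℂ} (hn : 0 < n) (hc : NotNonposInt c)
    (hs : NotNonposInt (c - a - n)) (hac : NotNonposInt (a + 1 - c)) (hb : NotNonposInt (-n + b))
    (hbc : NotNonposInt (1 + b - c)) : Has3F2One a b 1 c (-n + b + 1)
        ((c - 1) *
          (∑ L ∈ Finset.range n,
            Gamma (a + L + 1 - c) * Gamma (-n + b + L) /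
              (Gamma (L + 1) * Gamma (b - c - n + 2 + L))) *
          (-b + n) * Gamma n * Gamma (1 + b - c) /
          (Gamma (n + 1 - c + a) * Gamma b)) := by
  obtain ⟨n, rfl⟩ := Nat.exists_eq_succ_of_ne_zero hn.ne'
  rw [Nat.succ_eq_add_one] at *
  rw [show -((n + 1 : ℕ) : ℂ) + b = b - n - 1 by push_cast; ring] at *
  rw [show b - n - 1 + 1 = b - n by ring, show c - a - (n + 1 : ℕ) = c - a - n - 1 by push_cast; ring,
    show b - c - (n + 1 : ℕ) = b - n - c - 1 by push_cast; ring] at *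
  have hb' : NotNonposInt (b - n) := by simpa using hb.add_nat 1
  have key := has3F2One_of_upper (a := a) (b := b) (c := 1) (e := c) (f := b - n)
    (fun a => Gamma c * Gamma (b - n) * (-rGamma (c - 1) * rGamma b * n.factorial *
        ∑ L ∈ Finset.range (n + 1), rising (b - n - 1) L *
        (L.factorial : ℂ)⁻¹ * rising (b - n - c + 1 + L) (n - L) *
          (rising (a + 1 - c + L) (n + 1 - L))⁻¹)) hc hb'
    (by convert hs using 1; ring) ?_ ?_
  · convert key using 1
    have e1 := gamma_mul_rGamma_sub_one hc
    have e2 : Gamma ((n + 1 : ℕ) : ℂ) = n.factorial := by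
      rw [← Complex.Gamma_nat_eq_factorial]; push_cast; rfl
    have e3 : Gamma (b - n) = (b - n - 1) * Gamma (b - n - 1) := by
      rw [← Complex.Gamma_add_one _ hb.ne_zero, sub_add_cancel]
    have hsum : ∑ L ∈ Finset.range (n + 1),
            Gamma (a + L + 1 - c) * Gamma (b - n - 1 + L) /
              (Gamma (L + 1) * Gamma (b - n - c - 1 + 2 + L)) =
        (Gamma ((n + 1 : ℕ) + 1 - c + a) * Gamma (b - n - 1) * rGamma (1 + b - c)) *
        ∑ L ∈ Finset.range (n + 1), rising (b - n - 1) L *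
        (L.factorial : ℂ)⁻¹ * rising (b - n - c + 1 + L) (n - L) *
          (rising (a + 1 - c + L) (n + 1 - L))⁻¹ := by
      rw [Finset.mul_sum]
      refine Finset.sum_congr rfl fun L hL => ?_
      obtain ⟨j, rfl⟩ : ∃ j, n = L + j :=
        ⟨n - L, by have := Finset.mem_range.1 hL; omega⟩
      have hx := hac.add_nat L
      have f1 : Gamma ((L + j + 1 : ℕ) + 1 - c + a) =
          rising (a + 1 - c + L) (j + 1) * Gamma (a + 1 - c + L) := by
        rw [← hx.gamma_add_nat]; congr 1; push_cast; ring
      have f2 : (Gamma (b - (L + j : ℕ) - c - 1 + 2 + L))⁻¹ =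
          rising (b - (L + j : ℕ) - c + 1 + L) j * rGamma (1 + b - c) := by
        rw [show b - (L + j : ℕ) - c - 1 + 2 + L = b - (L + j : ℕ) - c + 1 + L by ring]
        change rGamma _ = _
        rw [rGamma_eq_rising_mul _ j]
        congr 2; push_cast; ring
      have f3 := hx.rising_ne_zero (j + 1)
      rw [show L + j + 1 - L = j + 1 by omega, Nat.add_sub_cancel_left, f1, div_eq_mul_inv, mul_inv,
        f2, Complex.Gamma_nat_eq_factorial, hb.gamma_add_nat,
        show a + L + 1 - c = a + 1 - c + L by ring]
      field_simp
    have g1 : Gamma ((n + 1 : ℕ) + 1 - c + a) ≠ 0 := by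
      have := (hac.add_nat (n + 1)).gamma_ne_zero
      convert this using 2; ring
    have g2 := hbc.gamma_mul_rGamma
    rw [hsum, e2, e3]
    generalize (Finset.sum (Finset.range (n + 1)) _ : ℂ) = Sg
    generalize Gamma ((n + 1 : ℕ) + 1 - c + a) = G at g1 ⊢
    have g3 := mul_inv_cancel₀ g1
    rw [div_eq_mul_inv, mul_inv]
    simp only [rGamma] at e1 g2 ⊢
    push_cast
    linear_combination (c - 1) * Gamma (b - n - 1) * Sg * (-b + (n + 1)) * n.factorial *
      (Gamma b)⁻¹ * (G * G⁻¹ * g2 + g3) + (b - n - 1) * Gamma (b - n - 1) * Sg * n.factorial *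
      (Gamma b)⁻¹ * e1
  · intro z h2
    have h4 : ∀ L ∈ Finset.range (n + 1), rising (z + 1 - c + L) (n + 1 - L) ≠ 0 := by
      intro L hL
      -- A zero of this denominator would make the excess c - z - n - 1 equal to -(n - L - j), an
      -- excluded value.
      refine rising_ne_zero _ fun j hj h => h2 (n - L - j) ?_
      have hL' := Nat.lt_succ_iff.1 (Finset.mem_range.1 hL)
      rw [Nat.cast_sub (by omega), Nat.cast_sub hL']
      linear_combination -h
    refine DifferentiableAt.const_mul (DifferentiableAt.const_mul
      (DifferentiableAt.fun_sum fun L hL => ?_) _) _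
    have h5 := h4 L hL
    have h6 : DifferentiableAt ℂ (fun z => rising (z + 1 - c + L) (n + 1 - L)) z := by fun_prop
    exact (h6.inv h5).const_mul _
  · intro z h2
    exact hasSum_hyp3F2Term hc hb'
      (hasSum_regTerm_one_sub n hb' (by convert h2 using 2; ring))

/-! ### Upper parameter `a` over the lower parameter `a - n + 1`, excess one -/

/-- The quotient (a)_k / Γ(a - n + k) = (a - n + k)_n / Γ(a) is a polynomial in k. Vandermonde
expands it in the (b + k)_L, and (b)_k (b + k)_L = (b)_L (b + L)_k makes each piece a Gauss series
of excess n + 1 - L ≥ 1. -/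
lemma hasSum_regTerm_sub_natCast (n : ℕ) (a b c : ℂ) :
    HasSum (regTerm a b c (a - n) (c + b + n + 1))
      (rGamma a * ∑ L ∈ Finset.range (n + 1), (n.choose L : ℂ) * (rising b L *
        rising (a - n - b) (n - L)) *
          (Gamma (n + 1 - L) * rGamma (c + n + 1 - L) * rGamma (b + n + 1))) := by
  have h : ∀ L ∈ Finset.range (n + 1), HasSum (gaussTerm (b + L) c (c + b + n + 1))
      (Gamma (n + 1 - L) * rGamma (c + n + 1 - L) * rGamma (b + n + 1)) := by
    intro L hL
    have hL' : (L : ℝ) ≤ n := Nat.cast_le.2 (Nat.lt_succ_iff.1 (Finset.mem_range.1 hL))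
    have e1 : c + b + n + 1 - (b + L) - c = n + 1 - L := by ring
    have := hasSum_gaussTerm (a := b + L) (b := c) (c := c + b + n + 1) (by
      rw [e1]; simp; linarith)
    rwa [e1, show c + b + n + 1 - (b + L) = c + n + 1 - L by ring,
      show c + b + n + 1 - c = b + n + 1 by ring] at this
  have h2 := (hasSum_sum fun L hL => (h L hL).mul_left
    ((n.choose L : ℂ) * (rising b L * rising (a - n - b) (n - L)))).mul_left (rGamma a)
  refine h2.of_eq (fun k => ?_) rfl
  have h3 : rGamma (a - n + k) = rising (a - n + k) n * rGamma (a + k) := by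
    rw [rGamma_eq_rising_mul _ n]; congr 2; ring
  have h4 : rising (a - n + k) n = ∑ L ∈ Finset.range (n + 1),
      (n.choose L : ℂ) * (rising (b + k) L * rising (a - n - b) (n - L)) := by
    rw [← rising_vandermonde]; congr 1; ring
  rw [regTerm, h3, h4, rGamma_eq_rising_mul a k, Finset.sum_mul, Finset.mul_sum, Finset.mul_sum, Finset.sum_mul,
    Finset.sum_mul]
  refine Finset.sum_congr rfl fun L _ => ?_
  rw [gaussTerm]
  linear_combination (rising a k * rGamma (a + k) * rising c k * rGamma (c + b + n + 1 + k) *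
    (k.factorial : ℂ)⁻¹ * n.choose L * rising (a - n - b) (n - L)) * rising_mul_comm b k L

lemma rGamma_one_sub {z : ℂ} (hz : NotNonposInt z) :
    rGamma (1 - z) = Gamma z * Complex.sin (Real.pi * z) / Real.pi := by
  have h := congrArg (·⁻¹) (Complex.Gamma_mul_Gamma_one_sub z)
  simp only [mul_inv, inv_div] at h
  have h1 := hz.gamma_ne_zero
  rw [rGamma, mul_div_assoc, ← h]
  field_simp

lemma hasSum_hyp3F2Term_sub_natCast {n : ℕ} {a b c : ℂ} (hn : 0 < n) (ha : NotNonposInt (a - n + 1))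
    (hf : NotNonposInt (c + b + n)) (hc : NotNonposInt (1 - c - n)) (hb : NotNonposInt b)
    (hba : NotNonposInt (b - a + n)) : HasSum (hyp3F2Term a b c (a - n + 1) (c + b + n))
        (-(Complex.sin (Real.pi * c) *
            (∑ L ∈ Finset.range n,
              Gamma (1 - c - n + L) * Gamma (b + L) / (Gamma (L + 1) * Gamma (b - a + 1 + L))) *
            Gamma (c + b + n) * Gamma (b - a + n) * Gamma (a - n + 1) * Gamma n /
            (Real.pi * Gamma b * Gamma a * Gamma (b + n)))) := by
  obtain ⟨n, rfl⟩ := Nat.exists_eq_succ_of_ne_zero hn.ne'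
  rw [Nat.succ_eq_add_one] at *
  have h0 : a - (n + 1 : ℕ) + 1 = a - n := by push_cast; ring
  have h1 : c + b + (n + 1 : ℕ) = c + b + n + 1 := by push_cast; ring
  have h2 : b + (n + 1 : ℕ) = b + n + 1 := by push_cast; ring
  have h3 : 1 - c - (n + 1 : ℕ) = -c - n := by push_cast; ring
  rw [h0] at ha ⊢
  rw [h1] at hf ⊢
  rw [h3] at hc ⊢
  rw [h2]
  refine (hasSum_hyp3F2Term ha hf (hasSum_regTerm_sub_natCast n a b c)).of_eq (fun k => rfl) ?_
  have e2 : Gamma ((n + 1 : ℕ) : ℂ) = n.factorial := by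
    rw [← Complex.Gamma_nat_eq_factorial]; push_cast; rfl
  have hsum : ∑ L ∈ Finset.range (n + 1), (n.choose L : ℂ) * (rising b L *
        rising (a - n - b) (n - L)) *
          (Gamma (n + 1 - L) * rGamma (c + n + 1 - L) * rGamma (b + n + 1)) =
      -(Complex.sin (Real.pi * c) * n.factorial * Gamma (b - a + (n + 1 : ℕ)) * rGamma b *
        rGamma (b + n + 1) / Real.pi) * ∑ L ∈ Finset.range (n + 1),
              Gamma (-c - n + L) * Gamma (b + L) / (Gamma (L + 1) * Gamma (b - a + 1 + L)) := by
    rw [Finset.mul_sum]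
    refine Finset.sum_congr rfl fun L hL => ?_
    obtain ⟨j, rfl⟩ : ∃ j, n = L + j :=
      ⟨n - L, by have := Finset.mem_range.1 hL; omega⟩
    have f1 : Gamma (((L + j : ℕ) : ℂ) + 1 - L) = j.factorial := by
      rw [← Complex.Gamma_nat_eq_factorial]; congr 1; push_cast; ring
    -- Reflection turns 1/Γ(c + j + 1) into Γ(-c - j); the sine of the closed form comes from here.
    have f2 : rGamma (c + (L + j : ℕ) + 1 - L) =
        -((-1) ^ j * Complex.sin (Real.pi * c) * Gamma (-c - (L + j : ℕ) + L) / Real.pi) := by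
      rw [show c + (L + j : ℕ) + 1 - L = 1 - (-c - (L + j : ℕ) + L) by ring,
        rGamma_one_sub (hc.add_nat L),
        show (Real.pi : ℂ) * (-c - (L + j : ℕ) + L) = -(Real.pi * c) - j * Real.pi by push_cast; ring,
        Complex.sin_antiperiodic.sub_nat_mul_eq, Complex.sin_neg]
      ring
    have f3 : rising (a - (L + j : ℕ) - b) j = (-1) ^ j * rising (b - a + 1 + L) j := by
      rw [rising_reflect]; congr 2; push_cast; ring
    have f4 : (Gamma (b - a + 1 + L))⁻¹ = rising (b - a + 1 + L) j * rGamma (b - a + (L + j + 1 : ℕ)) := by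
      change rGamma _ = _
      rw [rGamma_eq_rising_mul _ j]; congr 2; push_cast; ring
    have f5 : ((L + j).choose L : ℂ) * (j.factorial : ℂ) = (L + j).factorial * (L.factorial : ℂ)⁻¹ := by
      have hL0 : (L.factorial : ℂ) ≠ 0 := Nat.cast_ne_zero.2 L.factorial_ne_zero
      rw [eq_mul_inv_iff_mul_eq₀ hL0, ← Nat.add_choose_mul_factorial_mul_factorial L j,
        Nat.choose_symm_add]
      push_cast; ring
    have g1 := hba.gamma_mul_rGamma
    have g2 := hb.gamma_mul_rGamma
    have g3 := neg_one_pow_mul_self j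
    rw [Nat.add_sub_cancel_left, f1, f2, f3, div_eq_mul_inv (_ * _) (_ * _), mul_inv, f4,
      hb.gamma_add_nat, Complex.Gamma_nat_eq_factorial]
    calc _ = -(((L + j).choose L : ℂ) * (j.factorial : ℂ)) * rising b L * ((-1) ^ j * (-1) ^ j) *
          rising (b - a + 1 + L) j * Complex.sin (Real.pi * c) * Gamma (-c - (L + j : ℕ) + L) /
            Real.pi * rGamma (b + (L + j : ℕ) + 1) := by ring
      _ = -((L + j).factorial * (L.factorial : ℂ)⁻¹) * rising b L *
          rising (b - a + 1 + L) j * Complex.sin (Real.pi * c) * Gamma (-c - (L + j : ℕ) + L) /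
            Real.pi * rGamma (b + (L + j : ℕ) + 1) * (Gamma b * rGamma b) *
            (Gamma (b - a + (L + j + 1 : ℕ)) * rGamma (b - a + (L + j + 1 : ℕ))) := by
          rw [f5, g1, g2, g3]; ring
      _ = _ := by ring
  rw [hsum, e2]
  generalize (Finset.sum (Finset.range (n + 1)) _ : ℂ) = Sg
  simp only [rGamma, div_eq_mul_inv, mul_inv]
  ring

/-! ### Terminating series -/

lemma rising_neg_natCast (n k : ℕ) :
    rising (-n) k = (-1) ^ k * k.factorial * (n.choose k : ℂ) := by
  induction k with
  | zero => simp
  | succ k ih =>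
    have h : (n.choose (k + 1) : ℂ) * (k + 1) = n.choose k * (n - k) := by
      rcases le_or_gt k n with hk | hk
      · have := Nat.choose_succ_right_eq n k
        rw [← Nat.cast_sub hk]
        exact_mod_cast this
      · simp [Nat.choose_eq_zero_of_lt hk, Nat.choose_eq_zero_of_lt (hk.trans k.lt_succ_self)]
    rw [rising_succ, ih, pow_succ, Nat.factorial_succ]
    push_cast
    linear_combination ((-1) ^ k * k.factorial) * h

lemma hasSum_regTerm_neg_natCast (n : ℕ) (a b e f : ℂ) :
    HasSum (regTerm a b (-n) e f) (∑ k ∈ Finset.range (n + 1), (n.choose k : ℂ) *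
      ((-1) ^ k * rising a k * rising b k * rGamma (e + k) * rGamma (f + k))) := by
  have hterm : ∀ k, regTerm a b (-n) e f k = (n.choose k : ℂ) *
      ((-1) ^ k * rising a k * rising b k * rGamma (e + k) * rGamma (f + k)) := fun k => by
    have h : (k.factorial : ℂ) ≠ 0 := Nat.cast_ne_zero.2 k.factorial_ne_zero
    rw [regTerm, rising_neg_natCast]
    field_simp
  simp only [← hterm]
  refine hasSum_sum_of_ne_finset_zero fun k hk => ?_
  rw [hterm, Nat.choose_eq_zero_of_lt (by have := mt Finset.mem_range.2 hk; omega)]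
  simp

lemma choose_mul_choose_sub (M L i : ℕ) :
    M.choose L * (M - L).choose i = M.choose i * (M - i).choose L := by
  have h1 := Nat.choose_mul (n := M) (Nat.le_add_right L i)
  have h2 := Nat.choose_mul (n := M) (Nat.le_add_left i L)
  rw [Nat.add_sub_cancel_left] at h1
  rw [Nat.add_sub_cancel_right] at h2
  rw [← h1, ← h2, Nat.choose_symm_add]

/-- The factor (L - N - i)_i vanishes for N < L ≤ N + i and turns C(N + i, L) into a multiple of
C(N, L), which leaves a finite Gauss sum. -/
lemma sum_choose_rising_rGamma_mul (x y : ℂ) (N i : ℕ) :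
    ∑ L ∈ Finset.range (N + i + 1), ((N + i).choose L : ℂ) *
      ((-1) ^ L * rising x L * rGamma (y + L) * rising (L - (N + i : ℕ)) i) =
      (-1) ^ i * i.factorial * ((N + i).choose i : ℂ) * (rising (y - x) N * rGamma (y + N)) := by
  rw [← sum_choose_rising_rGamma, show N + i + 1 = N + 1 + i by ring, Finset.sum_range_add,
    Finset.sum_eq_zero (s := Finset.range i), add_zero, Finset.mul_sum]
  · refine Finset.sum_congr rfl fun L hL => ?_
    have hL' := Nat.lt_succ_iff.1 (Finset.mem_range.1 hL)
    have h := choose_mul_choose_sub (N + i) L i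
    rw [Nat.add_sub_cancel] at h
    have h2 : ((N + i).choose L : ℂ) * (N + i - L).choose i = (N + i).choose i * N.choose L := by
      exact_mod_cast h
    rw [show (L : ℂ) - (N + i : ℕ) = -((N + i - L : ℕ) : ℂ) by
      rw [Nat.cast_sub (by omega)]; ring, rising_neg_natCast]
    linear_combination ((-1) ^ L * rising x L * rGamma (y + L) * (-1) ^ i * i.factorial) * h2
  · intro r hr
    have hr' := Finset.mem_range.1 hr
    rw [show ((N + 1 + r : ℕ) : ℂ) - (N + i : ℕ) = -((i - 1 - r : ℕ) : ℂ) by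
      rw [Nat.cast_sub (by omega), Nat.cast_sub (by omega)]; push_cast; ring, rising_neg_natCast,
      Nat.choose_eq_zero_of_lt (show i - 1 - r < i by omega)]
    simp

/-- The terminating series with lower parameter `p + 1`. -/
lemma sum_choose_rising_eq (p n : ℕ) {a b c : ℂ} (ha : NotNonposInt (a - p)) :
    ∑ k ∈ Finset.range (n + 1), (n.choose k : ℂ) *
      ((-1) ^ k * rising a k * rising b k * rGamma (c + k) * rGamma (p + 1 + k)) =
    (-1) ^ n * (rising (a - p) p)⁻¹ * ((p + n).factorial : ℂ)⁻¹ *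
      ∑ L ∈ Finset.range (p + n + 1), ((p + n).choose L : ℂ) *
        ((-1) ^ L * rising (c - a) L * rGamma (c - p + L) * rising (b - p - n + L) n) := by
  have h1 : ∀ L ∈ Finset.range (p + n + 1), ((p + n).choose L : ℂ) *
        ((-1) ^ L * rising (c - a) L * rGamma (c - p + L) * rising (b - p - n + L) n) =
      ∑ k ∈ Finset.range (n + 1), (n.choose k : ℂ) * rising b k * (((p + n).choose L : ℂ) *
        ((-1) ^ L * rising (c - a) L * rGamma (c - p + L) * rising (L - (p + n : ℕ)) (n - k))) := by
    intro L _
    -- This splitting makes every inner sum over L a case of `sum_choose_rising_rGamma_mul`, whose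
    -- value contains (a - p)_{p+k} = (a - p)_p (a)_k.
    rw [show b - p - n + L = b + (L - (p + n : ℕ)) by push_cast; ring, rising_vandermonde,
      Finset.mul_sum, Finset.mul_sum]
    exact Finset.sum_congr rfl fun k _ => by ring
  rw [Finset.sum_congr rfl h1, Finset.sum_comm, Finset.mul_sum]
  refine Finset.sum_congr rfl fun k hk => ?_
  obtain ⟨j, rfl⟩ : ∃ j, n = k + j := ⟨n - k, by have := Finset.mem_range.1 hk; omega⟩
  have h2 := sum_choose_rising_rGamma_mul (c - a) (c - p) (p + k) j
  have h3 : c - p - (c - a) = a - p := by ring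
  have h4 : c - p + (p + k : ℕ) = c + k := by push_cast; ring
  rw [h3, h4, rising_add, sub_add_cancel] at h2
  rw [← Finset.mul_sum, Nat.add_sub_cancel_left, ← add_assoc p k j, h2,
    show (p : ℂ) + 1 + k = (p + k : ℕ) + 1 by push_cast; ring, rGamma_nat_succ]
  have h5 : ((p + k + j).choose j : ℂ) * (p + k).factorial * j.factorial = (p + k + j).factorial := by
    exact_mod_cast Nat.add_choose_mul_factorial_mul_factorial (p + k) j
  have h6 : ((p + k).factorial : ℂ) ≠ 0 := Nat.cast_ne_zero.2 (Nat.factorial_ne_zero _)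
  have h7 : ((p + k + j).factorial : ℂ) ≠ 0 := Nat.cast_ne_zero.2 (Nat.factorial_ne_zero _)
  have h8 := ha.rising_ne_zero p
  have h9 := neg_one_pow_mul_self j
  field_simp
  rw [pow_add]
  linear_combination ((k + j).choose k * rising a k * rising b k * rGamma (c + k)) *
    ((-(-1) ^ k * (-1) ^ j * (-1) ^ j) * h5 - (-1) ^ k * (p + k + j).factorial * h9)

lemma hasSum_hyp3F2Term_neg_natCast_sub {n m : ℕ} {a b c : ℂ} (hnm : n < m) (hc : NotNonposInt c)
    (ha : NotNonposInt (a + n - m + 1)) (hca : NotNonposInt (c - a))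
    (hb : NotNonposInt (1 + b - m + n)) :
      HasSum (hyp3F2Term a b (-n) c (m - n))
        (Gamma (a + n - m + 1) *
          (∑ L ∈ Finset.range m,
            (-1) ^ L * Gamma (c - a + L) * Gamma (1 + b - m + n + L) /
              (Gamma (m - L) * Gamma (b - m + 1 + L) * Gamma (c + n - m + 1 + L) *
                Gamma (L + 1))) *
          Gamma c * Gamma (m - n) * (-1) ^ n / (Gamma (c - a) * Gamma a)) := by
  obtain ⟨p, rfl⟩ : ∃ p, m = p + n + 1 := ⟨m - n - 1, by omega⟩
  have e1 : a + n - (p + n + 1 : ℕ) + 1 = a - p := by push_cast; ring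
  have e2 : 1 + b - (p + n + 1 : ℕ) + n = b - p := by push_cast; ring
  have e3 : ((p + n + 1 : ℕ) : ℂ) - n = p + 1 := by push_cast; ring
  have e4 : b - (p + n + 1 : ℕ) + 1 = b - p - n := by push_cast; ring
  have e5 : c + n - (p + n + 1 : ℕ) + 1 = c - p := by push_cast; ring
  rw [e1] at ha
  rw [e2] at hb
  rw [e1, e2, e3, e4, e5]
  have h := hasSum_regTerm_neg_natCast n a b c (p + 1)
  rw [sum_choose_rising_eq p n ha] at h
  refine (hasSum_hyp3F2Term hc (notNonposInt_natCast_succ p) h).of_eq (fun k => rfl) ?_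
  have hsum : ∑ L ∈ Finset.range (p + n + 1), (-1) ^ L * Gamma (c - a + L) * Gamma (b - p + L) /
        (Gamma ((p + n + 1 : ℕ) - L) * Gamma (b - p - n + L) * Gamma (c - p + L) * Gamma (L + 1)) =
      Gamma (c - a) * ((p + n).factorial : ℂ)⁻¹ * ∑ L ∈ Finset.range (p + n + 1),
        ((p + n).choose L : ℂ) *
        ((-1) ^ L * rising (c - a) L * rGamma (c - p + L) * rising (b - p - n + L) n) := by
    rw [Finset.mul_sum]
    refine Finset.sum_congr rfl fun L hL => ?_
    obtain ⟨j, hj⟩ : ∃ j, p + n = L + j :=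
      ⟨p + n - L, by have := Finset.mem_range.1 hL; omega⟩
    have f1 : Gamma ((p + n + 1 : ℕ) - (L : ℂ)) = j.factorial := by
      rw [← Complex.Gamma_nat_eq_factorial, hj]; congr 1; push_cast; ring
    have f2 : Gamma (b - p + L) * (Gamma (b - p - n + L))⁻¹ = rising (b - p - n + L) n := by
      change _ * rGamma _ = _
      have := (hb.add_nat L).gamma_mul_rGamma
      rw [rGamma_eq_rising_mul _ n, show b - p - n + L + n = b - p + L by ring]
      linear_combination rising (b - p - n + L) n * this
    have f3 : ((p + n).factorial : ℂ)⁻¹ * ((p + n).choose L : ℂ) =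
        (j.factorial : ℂ)⁻¹ * (L.factorial : ℂ)⁻¹ := by
      have h1 : (j.factorial : ℂ) ≠ 0 := Nat.cast_ne_zero.2 (Nat.factorial_ne_zero _)
      have h2 : (L.factorial : ℂ) ≠ 0 := Nat.cast_ne_zero.2 (Nat.factorial_ne_zero _)
      have h3 : ((L + j).factorial : ℂ) ≠ 0 := Nat.cast_ne_zero.2 (Nat.factorial_ne_zero _)
      have h4 : ((L + j).choose j : ℂ) * L.factorial * j.factorial = (L + j).factorial := by
        exact_mod_cast Nat.add_choose_mul_factorial_mul_factorial L j
      rw [hj, Nat.choose_symm_add]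
      field_simp
      linear_combination h4
    rw [f1, Complex.Gamma_nat_eq_factorial, hca.gamma_add_nat, rGamma, ← f2]
    rw [div_eq_mul_inv, mul_inv, mul_inv, mul_inv]
    linear_combination -((-1) ^ L * rising (c - a) L * Gamma (c - a) * Gamma (b - p + L) *
      (Gamma (b - p - n + L))⁻¹ * (Gamma (c - p + L))⁻¹) * f3
  rw [hsum]
  generalize (Finset.sum (Finset.range (p + n + 1)) _ : ℂ) = Sg
  have g1 : Gamma a = rising (a - p) p * Gamma (a - p) := by
    rw [← ha.gamma_add_nat, sub_add_cancel]
  have g2 := ha.rising_ne_zero p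
  have g3 := ha.gamma_ne_zero
  have g4 := hca.gamma_ne_zero
  rw [g1]
  field_simp

/-- The induction writes x - y = (x + L) - (y + L) under the sum. -/
lemma rising_sub (x y : ℂ) (N : ℕ) :
    rising (x - y) N = ∑ L ∈ Finset.range (N + 1), (N.choose L : ℂ) *
      ((-1) ^ L * rising y L * rising (x + L) (N - L)) := by
  induction N generalizing x with
  | zero => simp
  | succ N ih =>
    rw [sum_range_choose_succ fun i j => (-1) ^ i * rising y i * rising (x + i) j,
      rising_succ_left, show x - y + 1 = x + 1 - y by ring, ih, Finset.mul_sum]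
    refine Finset.sum_congr rfl fun L _ => ?_
    rw [rising_succ y, rising_succ_left (x + L), pow_succ]
    push_cast
    rw [show x + (L + 1) = x + L + 1 by ring, show x + 1 + L = x + L + 1 by ring]
    ring

/-- A generalisation of the Pfaff–Saalschütz identity. -/
lemma sum_choose_rising_saalschuetz (n q : ℕ) {b c δ : ℂ} (hC : NotNonposInt (c - b - q + n)) :
    ∑ k ∈ Finset.range (n + 1), (n.choose k : ℂ) *
      (rising (c - b - q - δ) k * rising b k * rising δ (n - k) * rGamma (c + k)) =
    Gamma (c - b - q + n) * rGamma (c - b) * ∑ L ∈ Finset.range (q + 1), (q.choose L : ℂ) *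
      ((-1) ^ L * rising b L * rising (δ + b + L) n * rGamma (c + n - q + L)) := by
  -- Both sides equal this sum: each becomes a double sum after expanding one rising factorial, and
  -- its other index is summed by the finite Gauss sum. For q = 0 the right side is the single
  -- product of the classical identity.
  trans rGamma (c + n) * ∑ i ∈ Finset.range (n + 1), (n.choose i : ℂ) *
    (rising b i * rising δ (n - i) * rising (c - b - q + n - i) i * rising (c - b) (n - i))
  · have h1 : ∀ k ∈ Finset.range (n + 1), (n.choose k : ℂ) *
        (rising (c - b - q - δ) k * rising b k * rising δ (n - k) * rGamma (c + k)) =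
        ∑ i ∈ Finset.range (n + 1), rising δ (n - i) * rising (c - b - q + n - i) i *
          ((n.choose k * k.choose i : ℕ) * ((-1) ^ (k - i) * rising b k * rGamma (c + k))) := by
      intro k hk
      obtain ⟨r, rfl⟩ : ∃ r, n = k + r := ⟨n - k, by have := Finset.mem_range.1 hk; omega⟩
      -- With r = n - k, the shift by r on both sides of the difference lets (δ)_r (δ + r)_j merge
      -- into (δ)_{r+j}.
      have h2 := rising_sub (c - b - q + r) (δ + r) k
      rw [show c - b - q + r - (δ + r) = c - b - q - δ by ring,
        ← Finset.sum_range_reflect] at h2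
      rw [show k + r + 1 = k + 1 + r by ring, Finset.sum_range_add _ (k + 1) r,
        Finset.sum_eq_zero (s := Finset.range r), add_zero, h2]
      · simp only [Finset.sum_mul, Finset.mul_sum]
        refine Finset.sum_congr rfl fun i hi => ?_
        obtain ⟨j, rfl⟩ : ∃ j, k = i + j := ⟨k - i, by have := Finset.mem_range.1 hi; omega⟩
        rw [show i + j + 1 - 1 - i = j by omega, show i + j - j = i by omega,
          show i + j + r - (i + j) = r by omega, show i + j + r - i = r + j by omega,
          show i + j - i = j by omega, rising_add δ r j, ← Nat.choose_symm_add,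
          show c - b - q + r + j = c - b - q + (i + j + r : ℕ) - i by push_cast; ring]
        push_cast
        ring
      · intro i hi
        rw [Nat.choose_eq_zero_of_lt (show k < k + 1 + i by omega)]
        simp
    rw [Finset.sum_congr rfl h1, Finset.sum_comm, Finset.mul_sum]
    refine Finset.sum_congr rfl fun i hi => ?_
    obtain ⟨r, rfl⟩ : ∃ r, n = i + r := ⟨n - i, by have := Finset.mem_range.1 hi; omega⟩
    have h3 := sum_choose_rising_rGamma (b + i) (c + i) r
    rw [← Finset.mul_sum, show i + r + 1 = i + (r + 1) by ring, Finset.sum_range_add,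
      Finset.sum_eq_zero (s := Finset.range i), zero_add]
    · have h4 : ∀ j ∈ Finset.range (r + 1), (((i + r).choose (i + j) * (i + j).choose i : ℕ) : ℂ) *
          ((-1) ^ (i + j - i) * rising b (i + j) * rGamma (c + (i + j : ℕ))) =
          (i + r).choose i * rising b i * ((r.choose j : ℂ) *
            ((-1) ^ j * rising (b + i) j * rGamma (c + i + j))) := by
        intro j hj
        have hj' := Nat.lt_succ_iff.1 (Finset.mem_range.1 hj)
        rw [Nat.choose_mul (Nat.le_add_right i j), Nat.add_sub_cancel_left,
          Nat.add_sub_cancel_left, rising_add]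
        push_cast
        rw [← add_assoc]
        ring
      rw [Finset.sum_congr rfl h4, ← Finset.mul_sum, h3, Nat.add_sub_cancel_left,
        show c + i - (b + i) = c - b by ring]
      push_cast
      rw [← add_assoc]
      ring_nf
    · intro k hk
      rw [Nat.choose_eq_zero_of_lt (Finset.mem_range.1 hk)]
      simp
  · have h1 : ∀ L ∈ Finset.range (q + 1), (q.choose L : ℂ) *
        ((-1) ^ L * rising b L * rising (δ + b + L) n * rGamma (c + n - q + L)) =
        ∑ i ∈ Finset.range (n + 1), (n.choose i : ℂ) * rising b i * rising δ (n - i) *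
          ((q.choose L : ℂ) * ((-1) ^ L * rising (b + i) L * rGamma (c + n - q + L))) := by
      intro L _
      rw [show δ + b + L = b + L + δ by ring, rising_vandermonde]
      simp only [Finset.sum_mul, Finset.mul_sum]
      refine Finset.sum_congr rfl fun i _ => ?_
      linear_combination ((q.choose L : ℂ) * (-1) ^ L * n.choose i * rising δ (n - i) *
        rGamma (c + n - q + L)) * rising_mul_comm b L i
    rw [Finset.sum_congr rfl h1, Finset.sum_comm, Finset.mul_sum, Finset.mul_sum]
    refine Finset.sum_congr rfl fun i hi => ?_
    obtain ⟨r, rfl⟩ : ∃ r, n = i + r := ⟨n - i, by have := Finset.mem_range.1 hi; omega⟩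
    rw [← Finset.mul_sum, sum_choose_rising_rGamma, Nat.add_sub_cancel_left,
      show c + (i + r : ℕ) - q + q = c + (i + r : ℕ) by ring,
      show c + (i + r : ℕ) - q - (b + i) = c - b - q + r by push_cast; ring,
      show c - b - q + (i + r : ℕ) - i = c - b - q + r by push_cast; ring]
    have h2 : rGamma (c - b) * rising (c - b - q + r) q = rising (c - b) r *
        (rising (c - b - q + r) i * rGamma (c - b - q + (i + r : ℕ))) := by
      have h3 : c - b - q + (i + r : ℕ) = c - b - q + r + i := by push_cast; ring
      rw [h3, ← rGamma_eq_rising_mul, rGamma_eq_rising_mul (c - b) r,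
        rGamma_eq_rising_mul (c - b - q + r) q, show c - b - q + r + q = c - b + r by ring]
      ring
    have h4 := hC.gamma_mul_rGamma
    linear_combination (-rGamma (c + (i + r : ℕ)) * (i + r).choose i * rising b i * rising δ r) *
      (rising (c - b) r * rising (c - b - q + r) i * h4 + Gamma (c - b - q + (i + r : ℕ)) * h2)

lemma hasSum_hyp3F2Term_neg_natCast_excess {n m : ℕ} {a b c : ℂ} (hm : 0 < m)
    (hc : NotNonposInt c) (hf : NotNonposInt (a - c + b - n + m))
    (hC : NotNonposInt (c - b + n - m + 1)) (hδ : NotNonposInt (-a + c - b - m + 1))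
    (hb : NotNonposInt b) (hz : NotNonposInt (1 - a + c - m + n)) :
      HasSum (hyp3F2Term a (-n) b c (a - c + b - n + m))
        (Gamma (c - b + n - m + 1) * Gamma (-a + c - b - m + 1) *
          (∑ L ∈ Finset.range m,
            (-1) ^ L * Gamma (b + L) * Gamma (1 - a + c - m + n + L) /
              (Gamma (m - L) * Gamma (-a + c - m + 1 + L) * Gamma (c + n - m + 1 + L) *
                Gamma (L + 1))) *
          Gamma m * Gamma c / (Gamma (n + 1 - a + c - b - m) * Gamma b * Gamma (c - b))) := by
  obtain ⟨q, rfl⟩ := Nat.exists_eq_succ_of_ne_zero hm.ne'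
  rw [Nat.succ_eq_add_one] at *
  -- In terms of δ = c - a - b - m + 1 the second lower parameter is 1 - δ - n, and reflection turns
  -- its rising factorials into those of δ.
  obtain ⟨δ, rfl⟩ : ∃ δ, a = c - b - q - δ := ⟨c - b - q - a, by ring⟩
  have e1 : c - b + n - (q + 1 : ℕ) + 1 = c - b - q + n := by push_cast; ring
  have e2 : -(c - b - q - δ) + c - b - (q + 1 : ℕ) + 1 = δ := by push_cast; ring
  have e3 : 1 - (c - b - q - δ) + c - (q + 1 : ℕ) + n = δ + b + n := by push_cast; ring
  have e4 : -(c - b - q - δ) + c - (q + 1 : ℕ) + 1 = δ + b := by push_cast; ring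
  have e5 : c + n - (q + 1 : ℕ) + 1 = c + n - q := by push_cast; ring
  have e6 : n + 1 - (c - b - q - δ) + c - b - (q + 1 : ℕ) = δ + n := by push_cast; ring
  have e7 : c - b - q - δ - c + b - n + (q + 1 : ℕ) = 1 - δ - n := by push_cast; ring
  have e8 : Gamma ((q + 1 : ℕ) : ℂ) = q.factorial := by
    rw [← Complex.Gamma_nat_eq_factorial]; push_cast; rfl
  rw [e1] at hC
  rw [e2] at hδ
  rw [e3] at hz
  rw [e7] at hf
  rw [e1, e2, e3, e4, e5, e6, e7, e8]
  have h := hasSum_hyp3F2Term hc hf (hasSum_regTerm_neg_natCast n (c - b - q - δ) b c (1 - δ - n))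
  refine h.of_eq (fun k => by simp only [hyp3F2Term]; ring) ?_
  have g0 := hδ.rising_ne_zero n
  have hL : Gamma (1 - δ - n) * ∑ k ∈ Finset.range (n + 1), (n.choose k : ℂ) *
      ((-1) ^ k * rising (c - b - q - δ) k * rising b k * rGamma (c + k) *
        rGamma (1 - δ - n + k)) = (rising δ n)⁻¹ * ∑ k ∈ Finset.range (n + 1), (n.choose k : ℂ) *
      (rising (c - b - q - δ) k * rising b k * rising δ (n - k) * rGamma (c + k)) := by
    rw [Finset.mul_sum, Finset.mul_sum]
    refine Finset.sum_congr rfl fun k hk => ?_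
    obtain ⟨r, rfl⟩ : ∃ r, n = k + r := ⟨n - k, by have := Finset.mem_range.1 hk; omega⟩
    have f1 : Gamma (1 - δ - (k + r : ℕ)) * rGamma (1 - δ - (k + r : ℕ) + k) =
        (-1) ^ k * rising δ r * (rising δ (k + r))⁻¹ := by
      have f2 := rising_reflect δ (k + r)
      have f3 := rising_reflect δ r
      have f4 := hf.rising_ne_zero (k + r)
      have f5 := hf.rising_ne_zero k
      rw [rising_add (1 - δ - (k + r : ℕ)) k r] at f2 f4
      rw [show 1 - δ - (k + r : ℕ) + k = 1 - δ - r by push_cast; ring] at f2 f4 ⊢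
      have f6 : rising (1 - δ - r) r ≠ 0 := right_ne_zero_of_mul f4
      have f7 : rGamma (1 - δ - r) = rGamma (1 - δ - (k + r : ℕ)) / rising (1 - δ - (k + r : ℕ)) k := by
        rw [← hf.rGamma_add_nat]; congr 1; push_cast; ring
      have f8 := hf.gamma_mul_rGamma
      rw [f7, f2, f3, pow_add]
      field_simp
      rw [f8]
    rw [Nat.add_sub_cancel_left]
    linear_combination ((k + r).choose k * (-1) ^ k * rising (c - b - q - δ) k * rising b k *
      rGamma (c + k)) * f1 + ((k + r).choose k * rising (c - b - q - δ) k * rising b k *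
      rGamma (c + k) * rising δ r * (rising δ (k + r))⁻¹) * neg_one_pow_mul_self k
  have hsum : ∑ L ∈ Finset.range (q + 1), (-1) ^ L * Gamma (b + L) * Gamma (δ + b + n + L) /
        (Gamma ((q + 1 : ℕ) - L) * Gamma (δ + b + L) * Gamma (c + n - q + L) * Gamma (L + 1)) =
      Gamma b * (q.factorial : ℂ)⁻¹ * ∑ L ∈ Finset.range (q + 1), (q.choose L : ℂ) *
      ((-1) ^ L * rising b L * rising (δ + b + L) n * rGamma (c + n - q + L)) := by
    rw [Finset.mul_sum]
    refine Finset.sum_congr rfl fun L hL => ?_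
    obtain ⟨j, rfl⟩ : ∃ j, q = L + j :=
      ⟨q - L, by have := Finset.mem_range.1 hL; omega⟩
    have f1 : Gamma ((L + j + 1 : ℕ) - (L : ℂ)) = j.factorial := by
      rw [← Complex.Gamma_nat_eq_factorial]; congr 1; push_cast; ring
    have f2 : Gamma (δ + b + n + L) * (Gamma (δ + b + L))⁻¹ = rising (δ + b + L) n := by
      change _ * rGamma _ = _
      have := (hz.add_nat L).gamma_mul_rGamma
      rw [rGamma_eq_rising_mul _ n, show δ + b + L + n = δ + b + n + L by ring]
      linear_combination rising (δ + b + L) n * this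
    have f3 : ((L + j).factorial : ℂ)⁻¹ * ((L + j).choose L : ℂ) =
        (j.factorial : ℂ)⁻¹ * (L.factorial : ℂ)⁻¹ := by
      have h1 : (j.factorial : ℂ) ≠ 0 := Nat.cast_ne_zero.2 (Nat.factorial_ne_zero _)
      have h2 : (L.factorial : ℂ) ≠ 0 := Nat.cast_ne_zero.2 (Nat.factorial_ne_zero _)
      have h3 : ((L + j).factorial : ℂ) ≠ 0 := Nat.cast_ne_zero.2 (Nat.factorial_ne_zero _)
      have h4 : ((L + j).choose j : ℂ) * L.factorial * j.factorial = (L + j).factorial := by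
        exact_mod_cast Nat.add_choose_mul_factorial_mul_factorial L j
      rw [Nat.choose_symm_add]
      field_simp
      linear_combination h4
    rw [f1, Complex.Gamma_nat_eq_factorial, hb.gamma_add_nat, rGamma, ← f2]
    rw [div_eq_mul_inv, mul_inv, mul_inv, mul_inv]
    linear_combination -((-1) ^ L * rising b L * Gamma b * Gamma (δ + b + n + L) *
      (Gamma (δ + b + L))⁻¹ * (Gamma (c + n - (L + j : ℕ) + L))⁻¹) * f3
  rw [mul_assoc (Gamma c), hL, sum_choose_rising_saalschuetz n q hC, hsum, hδ.gamma_add_nat]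
  generalize (Finset.sum (Finset.range (q + 1)) _ : ℂ) = Sg
  have g1 := hb.gamma_ne_zero
  have g2 := hδ.gamma_ne_zero
  have g3 : (q.factorial : ℂ) ≠ 0 := Nat.cast_ne_zero.2 (Nat.factorial_ne_zero _)
  rw [rGamma]
  field_simp

/-! ### Natural upper parameter `p + n + 1` over the lower parameter `p + 1` -/

/-- By Vandermonde the weights add up to a multiple of (k - p + 1)_{p+n}, which contains the factor
0 for k < p. -/
lemma sum_gaussTerm_eq_zero {a b c : ℂ} {p n k : ℕ} (hk : k < p) :
    ∑ L ∈ Finset.range (p + n + 1), ((p + n).choose L : ℂ) *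
      (rising (b - p) L * rising (1 - b) (p + n - L)) * gaussTerm (a - p) (b - p + L) (c - p) k =
    0 := by
  have h0 : rising (k - p + 1 : ℂ) (p + n) = 0 := by
    rw [rising_eq_prod]
    refine Finset.prod_eq_zero (i := p - 1 - k) (Finset.mem_range.2 (by omega)) ?_
    rw [Nat.cast_sub (by omega), Nat.cast_sub (by omega)]
    push_cast
    ring
  rw [show (k : ℂ) - p + 1 = b - p + k + (1 - b) by ring, rising_vandermonde] at h0
  have h1 := congrArg (fun x => x * (rising (a - p) k * rising (b - p) k * rGamma (c - p + k) *
    (k.factorial : ℂ)⁻¹)) h0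
  simp only [zero_mul, Finset.sum_mul] at h1
  rw [← h1]
  refine Finset.sum_congr rfl fun L _ => ?_
  rw [gaussTerm]
  linear_combination ((p + n).choose L * rising (1 - b) (p + n - L) * rising (a - p) k *
    rGamma (c - p + k) * (k.factorial : ℂ)⁻¹) * rising_mul_comm (b - p) L k

/-- At index k + p the same weight is (k + 1)_{p+n} = (p + n + k)!/k!, that is, (p + n)! (p + n +
1)_k / k!. -/
lemma sum_gaussTerm_eq_regTerm (a b c : ℂ) (p n k : ℕ) :
    ∑ L ∈ Finset.range (p + n + 1), ((p + n).choose L : ℂ) *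
      (rising (b - p) L * rising (1 - b) (p + n - L)) *
        gaussTerm (a - p) (b - p + L) (c - p) (k + p) =
    rising (a - p) p * rising (b - p) p * (p + n).factorial *
      regTerm a (p + n + 1 : ℕ) b c (p + 1) k := by
  have h0 := rising_vandermonde (b + k) (1 - b) (p + n)
  rw [show b + k + (1 - b) = (k : ℂ) + 1 by ring] at h0
  have h1 := rising_natCast_succ k (p + n)
  have h2 := rising_natCast_succ (p + n) k
  have h3 : rGamma ((p : ℂ) + 1 + k) = ((k + p).factorial : ℂ)⁻¹ := by
    rw [← rGamma_nat_succ]; congr 1; push_cast; ring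
  have h4 : rising (a - p) (k + p) = rising (a - p) p * rising a k := by
    rw [add_comm k, rising_add, sub_add_cancel]
  have h5 : rising (b - p) (k + p) = rising (b - p) p * rising b k := by
    rw [add_comm k, rising_add, sub_add_cancel]
  have h6 : (k.factorial : ℂ) ≠ 0 := Nat.cast_ne_zero.2 k.factorial_ne_zero
  have h7 : rising (b - p) p * rising b k * rising ((k : ℂ) + 1) (p + n) =
      ∑ L ∈ Finset.range (p + n + 1), ((p + n).choose L : ℂ) *
        (rising (b - p) L * rising (1 - b) (p + n - L)) * rising (b - p + L) (k + p) := by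
    rw [h0, Finset.mul_sum]
    refine Finset.sum_congr rfl fun L _ => ?_
    have h8 := rising_mul_comm (b - p) (k + p) L
    rw [h5, show b - p + (k + p : ℕ) = b + k by push_cast; ring] at h8
    linear_combination ((p + n).choose L * rising (1 - b) (p + n - L)) * h8
  calc _ = rising (a - p) p * rising a k * rGamma (c + k) * ((k + p).factorial : ℂ)⁻¹ *
        ∑ L ∈ Finset.range (p + n + 1), ((p + n).choose L : ℂ) *
          (rising (b - p) L * rising (1 - b) (p + n - L)) * rising (b - p + L) (k + p) := by
        rw [Finset.mul_sum]
        refine Finset.sum_congr rfl fun L _ => ?_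
        rw [gaussTerm, h4, show c - p + (k + p : ℕ) = c + k by push_cast; ring]
        ring
    _ = _ := by
        have h8 : rising ((k : ℂ) + 1) (p + n) =
            rising ((p + n + 1 : ℕ) : ℂ) k * (p + n).factorial * (k.factorial : ℂ)⁻¹ := by
          rw [Nat.cast_succ, h2, add_comm (p + n), ← h1, mul_inv_cancel_right₀ h6]
        rw [← h7, h8, regTerm, h3]
        ring

/-- The combination of Gauss series starts at index p, and the shift by p gives the wanted series.
The smallest excess among the Gauss series, at L = p + n, is exactly c - a - b - n. -/
lemma hasSum_regTerm_natCast (p n : ℕ) {a b c : ℂ} (ha : NotNonposInt (a - p))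
    (hb : NotNonposInt (1 - b)) (hs : 0 < (c - a - b - n).re) :
    HasSum (regTerm a (p + n + 1 : ℕ) b c (p + 1))
      ((rising (a - p) p * rising (b - p) p * (p + n).factorial)⁻¹ * rGamma (c - a) *
        ∑ L ∈ Finset.range (p + n + 1), ((p + n).choose L : ℂ) *
          (rising (b - p) L * rising (1 - b) (p + n - L)) *
            (Gamma (c - a - b + p - L) * rGamma (c - b - L))) := by
  have h : ∀ L ∈ Finset.range (p + n + 1), HasSum (gaussTerm (a - p) (b - p + L) (c - p))
      (Gamma (c - a - b + p - L) * rGamma (c - a) * rGamma (c - b - L)) := by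
    intro L hL
    have hL' : (L : ℝ) ≤ p + n := by
      exact_mod_cast Nat.lt_succ_iff.1 (Finset.mem_range.1 hL)
    have e1 : c - p - (a - p) - (b - p + L) = c - a - b + p - L := by ring
    have := hasSum_gaussTerm (a := a - p) (b := b - p + L) (c := c - p) (by
      rw [e1]; simp at hs ⊢; linarith)
    rwa [e1, show c - p - (a - p) = c - a by ring,
      show c - p - (b - p + L) = c - b - L by ring] at this
  have h2 := hasSum_sum fun L hL => (h L hL).mul_left
    (((p + n).choose L : ℂ) * (rising (b - p) L * rising (1 - b) (p + n - L)))
  rw [← hasSum_nat_add_iff' p, Finset.sum_eq_zero fun k hk =>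
    sum_gaussTerm_eq_zero (Finset.mem_range.1 hk), sub_zero] at h2
  have hap := ha.rising_ne_zero p
  have hbp : rising (b - p) p ≠ 0 := by
    rw [rising_reflect, show 1 - (b - p) - p = 1 - b by ring]
    exact mul_ne_zero (by simp) (hb.rising_ne_zero p)
  have hfac : ((p + n).factorial : ℂ) ≠ 0 := Nat.cast_ne_zero.2 (Nat.factorial_ne_zero _)
  refine (h2.mul_left (rising (a - p) p * rising (b - p) p * (p + n).factorial)⁻¹).of_eq
    (fun k => ?_) ?_
  · rw [sum_gaussTerm_eq_regTerm, inv_mul_cancel_left₀ (mul_ne_zero (mul_ne_zero hap hbp) hfac)]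
  · rw [mul_assoc, Finset.mul_sum (a := rGamma (c - a))]
    congr 1
    exact Finset.sum_congr rfl fun L _ => by ring

lemma has3F2One_natCast_natCast_sub {n m : ℕ} {a b c : ℂ} (hnm : n < m) (hc : NotNonposInt c)
    (hs : NotNonposInt (c - a - b - n)) (ha : NotNonposInt (a + n - m + 1))
    (hb : NotNonposInt (1 - b)) :
      Has3F2One a m b c (m - n)
        (Gamma (a + n - m + 1) *
          (∑ L ∈ Finset.range m,
            (-1) ^ L * Gamma (-b + c - a - n + L) * Gamma (1 - b + L) /
              (Gamma (m - L) * Gamma (-b - n + 1 + L) * Gamma (-b + c - m + 1 + L) *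
                Gamma (L + 1))) *
          Gamma c * Gamma (m - n) * (-1) ^ n / (Gamma (c - a) * Gamma a)) := by
  obtain ⟨p, rfl⟩ : ∃ p, m = p + n + 1 := ⟨m - n - 1, by omega⟩
  have e1 : a + n - (p + n + 1 : ℕ) + 1 = a - p := by push_cast; ring
  have e3 : ((p + n + 1 : ℕ) : ℂ) - n = p + 1 := by push_cast; ring
  rw [e1] at ha
  rw [e1, e3]
  have hp := notNonposInt_natCast_succ p
  have key := has3F2One_of_lower_left (a := a) (b := (p + n + 1 : ℕ)) (c := b) (e := c)
    (f := p + 1) (fun c => Gamma c * Gamma (p + 1) *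
      ((rising (a - p) p * rising (b - p) p * (p + n).factorial)⁻¹ * rGamma (c - a) *
        ∑ L ∈ Finset.range (p + n + 1), ((p + n).choose L : ℂ) *
          (rising (b - p) L * rising (1 - b) (p + n - L)) *
            (Gamma (c - a - b + p - L) * rGamma (c - b - L)))) hc hp
    (by convert hs using 1; push_cast; ring) ?_ ?_
  · convert key using 1
    have hsum : ∑ L ∈ Finset.range (p + n + 1),
            (-1) ^ L * Gamma (-b + c - a - n + L) * Gamma (1 - b + L) /
              (Gamma ((p + n + 1 : ℕ) - L) * Gamma (-b - n + 1 + L) *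
                Gamma (-b + c - (p + n + 1 : ℕ) + 1 + L) * Gamma (L + 1)) =
        (-1) ^ n * (rising (b - p) p)⁻¹ * ((p + n).factorial : ℂ)⁻¹ *
        ∑ L ∈ Finset.range (p + n + 1), ((p + n).choose L : ℂ) *
          (rising (b - p) L * rising (1 - b) (p + n - L)) *
            (Gamma (c - a - b + p - L) * rGamma (c - b - L)) := by
      -- The finite sum of the closed form runs in the opposite direction, L against p + n - L.
      rw [← Finset.sum_range_reflect (fun L : ℕ => ((p + n).choose L : ℂ) * _ * _),
        Finset.mul_sum]
      refine Finset.sum_congr rfl fun L hL => ?_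
      obtain ⟨j, hj⟩ : ∃ j, p + n = L + j :=
        ⟨p + n - L, by have := Finset.mem_range.1 hL; omega⟩
      have hjc : (p : ℂ) + n = L + j := by exact_mod_cast hj
      have f1 : Gamma ((p + n + 1 : ℕ) - (L : ℂ)) = j.factorial := by
        rw [← Complex.Gamma_nat_eq_factorial]; congr 1; push_cast; linear_combination hjc
      have f2 : rising (b - p) p = (-1) ^ p * rising (1 - b) p := by
        rw [rising_reflect]; congr 2; ring
      have f3 : rising (b - p) j = (-1) ^ j * rising (-b - n + 1 + L) j := by
        rw [rising_reflect]; congr 2; linear_combination hjc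
      have f4 : (Gamma (-b - n + 1 + L))⁻¹ =
          rising (-b - n + 1 + L) j * (rGamma (1 - b) / rising (1 - b) p) := by
        change rGamma _ = _
        rw [rGamma_eq_rising_mul _ j, ← hb.rGamma_add_nat]; congr 2; linear_combination -hjc
      have f5 : ((L + j).choose L : ℂ) * ((L + j).factorial : ℂ)⁻¹ =
          (L.factorial : ℂ)⁻¹ * (j.factorial : ℂ)⁻¹ := by
        have h1 : (j.factorial : ℂ) ≠ 0 := Nat.cast_ne_zero.2 (Nat.factorial_ne_zero _)
        have h2 : (L.factorial : ℂ) ≠ 0 := Nat.cast_ne_zero.2 (Nat.factorial_ne_zero _)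
        have h3 : ((L + j).factorial : ℂ) ≠ 0 := Nat.cast_ne_zero.2 (Nat.factorial_ne_zero _)
        have h4 : ((L + j).choose j : ℂ) * L.factorial * j.factorial = (L + j).factorial := by
          exact_mod_cast Nat.add_choose_mul_factorial_mul_factorial L j
        rw [Nat.choose_symm_add]
        field_simp
        linear_combination h4
      have f6 : (-1 : ℂ) ^ n * ((-1) ^ p)⁻¹ = (-1) ^ L * (-1) ^ j := by
        rw [← pow_add, ← hj, pow_add, inv_eq_of_mul_eq_one_left (neg_one_pow_mul_self p), mul_comm]
      have f7 := hb.gamma_mul_rGamma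
      have f8 := neg_one_pow_mul_self j
      rw [f1, div_eq_mul_inv, mul_inv, mul_inv, mul_inv, f4, hb.gamma_add_nat,
        Complex.Gamma_nat_eq_factorial, hj, show L + j + 1 - 1 - L = j by omega,
        Nat.add_sub_cancel_right, f2, f3, mul_inv, ← Nat.choose_symm_add,
        show c - a - b + p - j = -b + c - a - n + L by linear_combination hjc,
        show -b + c - (L + j + 1 : ℕ) + 1 + L = c - b - j by push_cast; ring]
      change _ * (_ * rGamma (c - b - j) * _) = _
      set W := Gamma (-b + c - a - n + L) * rGamma (c - b - j) * rising (1 - b) L *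
        rising (-b - n + 1 + L) j * (rising (1 - b) p)⁻¹
      calc _ = (-1) ^ L * W * ((L.factorial : ℂ)⁻¹ * (j.factorial : ℂ)⁻¹) *
            (Gamma (1 - b) * rGamma (1 - b)) := by simp only [W]; ring
        _ = (-1) ^ L * ((-1) ^ j * (-1) ^ j) * W *
            (((L + j).choose L : ℂ) * ((L + j).factorial : ℂ)⁻¹) := by rw [f5, f7, f8]; ring
        _ = ((-1 : ℂ) ^ n * ((-1) ^ p)⁻¹) * (-1) ^ j * W *
            (((L + j).choose L : ℂ) * ((L + j).factorial : ℂ)⁻¹) := by rw [f6]; ring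
        _ = _ := by simp only [W]; ring
    have g1 : Gamma a = rising (a - p) p * Gamma (a - p) := by
      rw [← ha.gamma_add_nat, sub_add_cancel]
    have g2 := mul_inv_cancel₀ ha.gamma_ne_zero
    have g3 := neg_one_pow_mul_self n
    rw [hsum, g1]
    generalize (Finset.sum (Finset.range (p + n + 1)) _ : ℂ) = Sg
    rw [rGamma, div_eq_mul_inv, mul_inv, mul_inv, mul_inv, mul_inv]
    set W := (rising (b - p) p)⁻¹ * ((p + n).factorial : ℂ)⁻¹ * Sg * Gamma c * Gamma (p + 1) *
      (Gamma (c - a))⁻¹ * (rising (a - p) p)⁻¹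
    calc _ = W * (Gamma (a - p) * (Gamma (a - p))⁻¹) * ((-1) ^ n * (-1) ^ n) := by
          simp only [W]; ring
      _ = _ := by rw [g2, g3]; simp only [W]; ring
  · intro z h1 h2
    have h3 := Complex.differentiableAt_Gamma z h1
    have h4 := differentiable_rGamma
    refine (h3.mul_const _).mul (DifferentiableAt.mul (by fun_prop)
      (DifferentiableAt.fun_sum fun L hL => ?_))
    have h5 := NotNonposInt.differentiableAt_gamma_add (z := z) (w := -a - b + p - L) (by
      -- The argument of Γ is the excess plus the natural number p + n - L, hence no pole.
      have := h2.add_nat (p + n - L)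
      rw [Nat.cast_sub (Nat.lt_succ_iff.1 (Finset.mem_range.1 hL))] at this
      convert this using 1; push_cast; ring)
    simp only [show ∀ z, z - a - b + p - L = z + (-a - b + p - L) from fun z => by ring]
    fun_prop
  · intro z h1 h2
    exact hasSum_hyp3F2Term h1 hp
      (hasSum_regTerm_natCast p n ha hb (by convert h2 using 2; push_cast; ring))

/-! ### The ten formulas -/

theorem mainTheorem6 :
    -- (1) excess `c - a - b - n`
    (∀ (n m : ℕ) (a b c : ℂ), 0 < n → n < m →
      NotNonposInt c → NotNonposInt (c - a - b - n) →
      NotNonposInt (a + n - m + 1) → NotNonposInt (1 - b) →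
      Has3F2One a m b c (m - n)
        (Gamma (a + n - m + 1) *
          (∑ L ∈ Finset.range m,
            (-1) ^ L * Gamma (-b + c - a - n + L) * Gamma (1 - b + L) /
              (Gamma (m - L) * Gamma (-b - n + 1 + L) * Gamma (-b + c - m + 1 + L) *
                Gamma (L + 1))) *
          Gamma c * Gamma (m - n) * (-1) ^ n / (Gamma (c - a) * Gamma a))) ∧
    -- (2) terminating, excess `c - a - b + m`
    (∀ (n m : ℕ) (a b c : ℂ), 0 < n → n < m →
      NotNonposInt c → NotNonposInt (a + n - m + 1) →
      NotNonposInt (c - a) → NotNonposInt (1 + b - m + n) →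
      HasSum (hyp3F2Term a b (-n) c (m - n))
        (Gamma (a + n - m + 1) *
          (∑ L ∈ Finset.range m,
            (-1) ^ L * Gamma (c - a + L) * Gamma (1 + b - m + n + L) /
              (Gamma (m - L) * Gamma (b - m + 1 + L) * Gamma (c + n - m + 1 + L) *
                Gamma (L + 1))) *
          Gamma c * Gamma (m - n) * (-1) ^ n / (Gamma (c - a) * Gamma a))) ∧
    -- (3) terminating, excess `m`
    (∀ (n m : ℕ) (a b c : ℂ), 0 < n → 0 < m →
      NotNonposInt c → NotNonposInt (a - c + b - n + m) →
      NotNonposInt (c - b + n - m + 1) → NotNonposInt (-a + c - b - m + 1) →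
      NotNonposInt b → NotNonposInt (1 - a + c - m + n) →
      HasSum (hyp3F2Term a (-n) b c (a - c + b - n + m))
        (Gamma (c - b + n - m + 1) * Gamma (-a + c - b - m + 1) *
          (∑ L ∈ Finset.range m,
            (-1) ^ L * Gamma (b + L) * Gamma (1 - a + c - m + n + L) /
              (Gamma (m - L) * Gamma (-a + c - m + 1 + L) * Gamma (c + n - m + 1 + L) *
                Gamma (L + 1))) *
          Gamma m * Gamma c / (Gamma (n + 1 - a + c - b - m) * Gamma b * Gamma (c - b)))) ∧
    -- (4) excess `c - a - b + n`
    (∀ (n : ℕ) (a b c : ℂ), 0 < n →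
      NotNonposInt c → NotNonposInt (c - a - b + n) →
      NotNonposInt (a - n) → NotNonposInt (b - n) → NotNonposInt (1 - b) →
      Has3F2One a 1 b (n + 1) c
        (Gamma (a - n) * Gamma (b - n) * Gamma (n + 1) * Gamma c * Gamma (-b + c - a + n) /
            (Gamma b * Gamma (c - b) * Gamma a * Gamma (c - a)) +
          Gamma (-b + 1) *
            (∑ L ∈ Finset.range n,
              Gamma (-L + a - 1) * (-1) ^ L /
                (Gamma (c - 1 - L) * Gamma (n - L) * Gamma (-b + 2 + L))) *
            Gamma (n + 1) * Gamma c / Gamma a)) ∧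
    -- (5) excess `c - a - b + 1`
    (∀ (n : ℕ) (a b c : ℂ), 0 < n →
      NotNonposInt c → NotNonposInt (c - a - b + 1) →
      NotNonposInt (a - n) → NotNonposInt (b - n) → NotNonposInt (1 - b) →
      Has3F2One a b n (n + 1) c
        (Gamma (b - n) *
            (∑ L ∈ Finset.range n,
              Gamma (-L + a - 1) * (-1) ^ L /
                (Gamma (-b + c - L) * Gamma (n - L) * Gamma (b + 1 + L - n))) *
            Gamma (n + 1) * Gamma c * Gamma (-b + c - a + 1) / (Gamma a * Gamma (c - a)) +
          Gamma (a - n) * Gamma (-b + 1) * Gamma (n + 1) * Gamma c /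
            (Gamma (n + 1 - b) * Gamma (c - n) * Gamma a))) ∧
    -- (6) excess `n`
    (∀ (n : ℕ) (a b c : ℂ), 0 < n →
      NotNonposInt c → NotNonposInt (-c + b + a + n + 1) →
      NotNonposInt (-c + a + 1) → NotNonposInt (-b + c - n) → NotNonposInt (c - a - n) →
      HasSum (hyp3F2Term 1 a b c (-c + b + a + n + 1))
        ((-c + b + a + n) * Gamma (-c + a + 1) *
            (∑ L ∈ Finset.range n,
              Gamma (-L + c - b - 1) * (-1) ^ L /
                (Gamma (c - 1 - L) * Gamma (n - L) * Gamma (-c + a + 2 + L))) *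
            Gamma n * Gamma c / Gamma (c - b) +
          Gamma (-c + b + a + n + 1) * Gamma (-b + c - n) * Gamma (c - a - n) * Gamma n *
            Gamma c / (Gamma (c - a) * Gamma a * Gamma (c - b) * Gamma b))) ∧
    -- (7) excess `1`
    (∀ (n : ℕ) (a b c : ℂ), 0 < n →
      NotNonposInt c → NotNonposInt (-c + b + a + n + 1) →
      NotNonposInt (-b + c - n) → NotNonposInt (c - a - n) →
      HasSum (hyp3F2Term n a b c (-c + b + a + n + 1))
        (Gamma (-c + b + a + n + 1) * Gamma (c - a - n) *
            (∑ L ∈ Finset.range n,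
              Gamma (-L + c - b - 1) * (-1) ^ L /
                (Gamma (a - L) * Gamma (n - L) * Gamma (c + 1 - a - n + L))) *
            Gamma c / (Gamma (c - b) * Gamma b) +
          Gamma (-c + b + a + n + 1) * Gamma (-b + c - n) * (-1) ^ n * Gamma (c - a - n) *
            Gamma c /
            (Gamma (c - a) * Gamma (c - n) * Gamma (c - b) * Gamma (-c + b + 1 + a)))) ∧
    -- (8) excess `1`
    (∀ (n : ℕ) (a b c : ℂ), 0 < n →
      NotNonposInt (a - n + 1) → NotNonposInt (c + b + n) →
      NotNonposInt (1 - c - n) → NotNonposInt b → NotNonposInt (b - a + n) →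
      HasSum (hyp3F2Term a b c (a - n + 1) (c + b + n))
        (-(Complex.sin (Real.pi * c) *
            (∑ L ∈ Finset.range n,
              Gamma (1 - c - n + L) * Gamma (b + L) / (Gamma (L + 1) * Gamma (b - a + 1 + L))) *
            Gamma (c + b + n) * Gamma (b - a + n) * Gamma (a - n + 1) * Gamma n /
            (Real.pi * Gamma b * Gamma a * Gamma (b + n))))) ∧
    -- (9) excess `b - c - n + 2 - a`
    (∀ (n : ℕ) (a b c : ℂ), 0 < n →
      NotNonposInt (-n + b + 1) → NotNonposInt (b - c - n + 2 - a) →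
      NotNonposInt (-b + a) → NotNonposInt (-c - n + b + 1) → NotNonposInt (-c + 1) →
      Has3F2One a b c (b + 1) (-n + b + 1)
        (-(-1) ^ n * b *
          (∑ L ∈ Finset.range n,
            Gamma (-b + a + L) * Gamma (-c - n + b + 1 + L) /
              (Gamma (L + 1) * Gamma (-c - n + 2 + L))) *
          Gamma (b - c - n + 2 - a) * Gamma (-n + b + 1) * Gamma n * Gamma (-c + 1) /
          (Gamma (a - b) * Gamma (b - a + 1) * Gamma (b - c - n + 1) * Gamma (1 + b - c)))) ∧
    -- (10) excess `c - a - n`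
    (∀ (n : ℕ) (a b c : ℂ), 0 < n →
      NotNonposInt c → NotNonposInt (c - a - n) →
      NotNonposInt (a + 1 - c) → NotNonposInt (-n + b) → NotNonposInt (1 + b - c) →
      Has3F2One a b 1 c (-n + b + 1)
        ((c - 1) *
          (∑ L ∈ Finset.range n,
            Gamma (a + L + 1 - c) * Gamma (-n + b + L) /
              (Gamma (L + 1) * Gamma (b - c - n + 2 + L))) *
          (-b + n) * Gamma n * Gamma (1 + b - c) /
          (Gamma (n + 1 - c + a) * Gamma b))) := by
  refine ⟨?_, ?_, ?_, ?_, ?_, ?_, ?_, ?_, ?_, ?_⟩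
  · intro n m a b c _ hnm hc hs ha hb
    exact has3F2One_natCast_natCast_sub hnm hc hs ha hb
  · intro n m a b c _ hnm hc ha hca hb
    exact hasSum_hyp3F2Term_neg_natCast_sub hnm hc ha hca hb
  · intro n m a b c _ hm hc hf hC hδ hb hz
    exact hasSum_hyp3F2Term_neg_natCast_excess hm hc hf hC hδ hb hz
  · intro n a b c hn hc hs ha hb hb1
    exact has3F2One_one_natCast_succ hn hc hs ha hb hb1
  · intro n a b c _ hc hs ha hb hb1
    exact has3F2One_natCast_natCast_succ hc hs ha hb hb1
  · intro n a b c hn hc hf hac hb ha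
    exact hasSum_hyp3F2Term_one_excess hn hc hf hac hb ha
  · intro n a b c _ hc hf hb ha
    exact hasSum_hyp3F2Term_natCast_excess_one hc hf hb ha
  · intro n a b c hn ha hf hc hb hba
    exact hasSum_hyp3F2Term_sub_natCast hn ha hf hc hb hba
  · intro n a b c hn hb hs hab hbc hc
    exact has3F2One_self_add_one hn hb hs hab hbc hc
  · intro n a b c hn hc hs hac hb hbc
    exact has3F2One_one_sub hn hc hs hac hb hbc
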